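/- Let $N\ge 1$ and let $1\le m\le N$ be an integer, and let $0<\gamma<N$, $0<\alpha<\frac{2}{\gamma+m}$. Put $\Omega_m=\{x\in\mathbb R^N: x_1>0,\dots,x_m>0\}$, $$\psi_0(x)=\gamma(\gamma+2)\cdots(\gamma+2m-2)\,x_1\cdots x_m\,|x|^{-\gamma-2m}\quad (x\in\Omega_m),\qquad \mathcal X=\{\psi\in L^1_{\rm loc}(\Omega_m):\ \psi/\psi_0\in L^\infty(\Omega_m)\},$$ and let $e^{t\Delta_m}$ be the heat semigroup on $\Omega_m$ with Dirichlet boundary conditions, i.e. the integral operator on $\Omega_m$ with kernel $$(4\pi t)^{-N/2}\prod_{i\le m}\Bigl(e^{-(x_i-y_i)^2/4t}-e^{-(x_i+y_i)^2/4t}\Bigr)\prod_{i>m}e^{-(x_i-y_i)^2/4t}.$$ Let $\varphi\in L^1_{\rm loc}(\mathbb R^N\setminus\{0\})$ be anti-symmetric with respect to each of $x_1,\dots,x_m$, with $\varphi|_{\Omega_m}\in\mathcal X$ and $\varphi\ge 0$ on $\Omega_m$. Let $\omega\in L^\infty(\mathbb R^N)$ be homogeneous of degree $0$, anti-symmetric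 with respect to each of $x_1,\dots,x_m$, with $\omega\ge 0$ on $\Omega_m$ and $\omega\not\equiv 0$, and suppose that for some $\epsilon>0$ $$\varphi(x)\ge\omega(x)\psi_0(x)\quad\text{for } x\in\Omega_m,\ |x|\le\epsilon .$$ (All pointwise relations between these functions are understood almost everywhere.) For $\lambda>0$ let $T_{\max}(\lambda\varphi)\in[0,\infty]$ be the existence time of the maximal solution $u:(0,T_{\max})\to C_0(\mathbb R^N)$ of $\partial_tu=\Delta u+|u|^\alpha u$ with $u(0)=\lambda\varphi$. That is, $T_{\max}(\lambda\varphi)$ is the supremum of the $T>0$ for which there is $u\in C((0,T);C_0(\mathbb R^N))$, of any sign, anti-symmetric with respect to $x_1,\dots,x_m$, such that $$u(t)=e^{t\Delta_m}(\lambda\varphi)+\int_0^te^{(t-s)\Delta_m}\bigl(|u(s)|^\alpha u(s)\bigr)\,ds\quad\text{on }\Omega_m,\ 0<t<T,$$ and such that for each $T'<T$ the quotient $|u(t)|/e^{t\Delta_m}\psi_0$ is bounded on $\Omega_m$ uniformly in $0<t\le T'$. Let also $T^{+}_{\max}(\lambda\varphi)\in[0,\infty]$ be the supremum of the $T>0$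 for which there is a measurable function $u:(0,T)\times\Omega_m\to[0,\infty)$ that satisfies this integral equation almost everywhere in $(0,T)\times\Omega_m$. Then $0<\|e^{\Delta_m}(\omega\psi_0)\|_{L^\infty(\Omega_m)}<\infty$, and for both $T_*=T_{\max}$ and $T_*=T^{+}_{\max}$ one has $T_*(\lambda\varphi)<\infty$ for all sufficiently large $\lambda>0$ and $$\limsup_{\lambda\to\infty}\lambda^{\left(\frac1\alpha-\frac{\gamma+m}{2}\right)^{-1}}T_*(\lambda\varphi)\ \le\ \frac{1}{\left(\alpha^{1/\alpha}\,\|e^{\Delta_m}(\omega\psi_0)\|_{L^\infty(\Omega_m)}\right)^{\left(\frac1\alpha-\frac{\gamma+m}{2}\right)^{-1}}}.$$ -/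

import Mathlib

open MeasureTheory Filter Set
open scoped ENNReal NNReal ZeroAtInfty

noncomputable section

namespace SectorHeat

variable {N : ℕ}

/-- The sector `Ω_m = {x ∈ ℝ^N : x_1 > 0, …, x_m > 0}`.  Coordinates are indexed by `Fin N`, so the
first `m` of them are those with index `< m`. -/
def sector (N m : ℕ) : Set (EuclideanSpace ℝ (Fin N)) :=
  {x | ∀ i : Fin N, (i : ℕ) < m → 0 < x i}

/-- The reflection of `ℝ^N` that changes the sign of the `i`-th coordinate. -/
def flipCoord (i : Fin N) (x : EuclideanSpace ℝ (Fin N)) : EuclideanSpace ℝ (Fin N) :=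
  WithLp.toLp 2 (fun j => if j = i then - x j else x j)

/-- `f` is anti-symmetric with respect to `x_1, …, x_m` (as an almost everywhere defined function). -/
def AntiSymmetric (m : ℕ) (f : EuclideanSpace ℝ (Fin N) → ℝ) : Prop :=
  ∀ i : Fin N, (i : ℕ) < m → ∀ᵐ x, f (flipCoord i x) = - f x

/-- `f` is homogeneous of degree `0` (as an almost everywhere defined function). -/
def HomogeneousZero (f : EuclideanSpace ℝ (Fin N) → ℝ) : Prop :=
  ∀ r : ℝ, 0 < r → ∀ᵐ x, f (r • x) = f x

/-- `ψ₀(x) = c_{m,γ} x_1 ⋯ x_m |x|^{-γ-2m}` with `c_{m,γ} = γ (γ+2) ⋯ (γ+2m-2)`. -/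
def psi0 (m : ℕ) (γ : ℝ) (x : EuclideanSpace ℝ (Fin N)) : ℝ :=
  (∏ j ∈ Finset.range m, (γ + 2 * (j : ℝ))) *
    (∏ i : Fin N, if (i : ℕ) < m then x i else 1) * ‖x‖ ^ (-γ - 2 * (m : ℝ))

/-- The space `𝒳` of functions `ψ ∈ L¹_loc(Ω_m)` with `ψ / ψ₀ ∈ L^∞(Ω_m)`. -/
def MemX (m : ℕ) (γ : ℝ) (f : EuclideanSpace ℝ (Fin N) → ℝ) : Prop :=
  LocallyIntegrableOn f (sector N m) ∧
    MemLp (fun x => f x / psi0 m γ x) ∞ (volume.restrict (sector N m))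

/-- The heat kernel of `Ω_m` with Dirichlet boundary conditions: the product of the heat kernels of
`m` half-lines (obtained by reflection) and of `N - m` lines. -/
def kernel (m : ℕ) (t : ℝ) (x y : EuclideanSpace ℝ (Fin N)) : ℝ :=
  (4 * Real.pi * t) ^ (-(N : ℝ) / 2) *
    ∏ i : Fin N,
      if (i : ℕ) < m then
        Real.exp (-(x i - y i) ^ 2 / (4 * t)) - Real.exp (-(x i + y i) ^ 2 / (4 * t))
      else Real.exp (-(x i - y i) ^ 2 / (4 * t))

/-- The heat semigroup `e^{tΔ_m}` on `Ω_m`, for `t > 0`. -/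
def heat (m : ℕ) (t : ℝ) (f : EuclideanSpace ℝ (Fin N) → ℝ) (x : EuclideanSpace ℝ (Fin N)) : ℝ :=
  ∫ y in sector N m, kernel m t x y * f y

/-- The heat semigroup `e^{tΔ_m}` acting on functions with values in `[0, ∞]`. -/
def heatPos (m : ℕ) (t : ℝ) (f : EuclideanSpace ℝ (Fin N) → ℝ≥0∞)
    (x : EuclideanSpace ℝ (Fin N)) : ℝ≥0∞ :=
  ∫⁻ y in sector N m, ENNReal.ofReal (kernel m t x y) * f y

/-- `u : (0,T) → C₀(ℝ^N)` is a regular solution, of any sign, of `∂ₜu = Δu + |u|^α u` with initial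
value `φ`, where `φ` is anti-symmetric in `x_1, …, x_m` and its restriction to `Ω_m` lies in `𝒳`:
`u` is continuous in time, anti-symmetric in `x_1, …, x_m`, it solves
`u(t) = e^{tΔ_m} φ + ∫₀ᵗ e^{(t-s)Δ_m} (|u(s)|^α u(s)) ds` on `Ω_m`, and it belongs to the class of
well-posedness: `u(t) / e^{tΔ_m} ψ₀` stays bounded on `Ω_m` up to the initial time.  (On
anti-symmetric functions the heat semigroup of `ℝ^N` is the anti-symmetric extension of
`e^{tΔ_m}`.) -/
structure IsRegularSolution (m : ℕ) (α γ : ℝ) (φ : EuclideanSpace ℝ (Fin N) → ℝ) (T : ℝ)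
    (u : ℝ → C₀(EuclideanSpace ℝ (Fin N), ℝ)) : Prop where
  continuousOn : ContinuousOn u (Ioo 0 T)
  antisymmetric : ∀ t ∈ Ioo 0 T, AntiSymmetric m (u t)
  bound : ∀ T' : ℝ, T' < T → ∃ M : ℝ, ∀ t ∈ Ioc 0 T', ∀ x ∈ sector N m,
    |u t x| ≤ M * heat m t (psi0 m γ) x
  integral_eq : ∀ t ∈ Ioo 0 T, ∀ x ∈ sector N m,
    u t x = heat m t φ x + ∫ s in (0 : ℝ)..t, heat m (t - s) (fun y => |u s y| ^ α * u s y) x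

/-- The existence time `T_max(φ) ∈ [0, ∞]` of the maximal regular solution. -/
def Tmax (m : ℕ) (α γ : ℝ) (φ : EuclideanSpace ℝ (Fin N) → ℝ) : ℝ≥0∞ :=
  sSup {τ | ∃ T : ℝ, 0 < T ∧ τ = ENNReal.ofReal T ∧
    ∃ u : ℝ → C₀(EuclideanSpace ℝ (Fin N), ℝ), IsRegularSolution m α γ φ T u}

/-- `u` is a nonnegative solution on `(0,T) × Ω_m` of the integral equation
`u(t) = e^{tΔ_m} φ + ∫₀ᵗ e^{(t-s)Δ_m} u(s)^{α+1} ds` with initial value `φ ≥ 0`: `u` is measurable,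
has finite values, and the equation holds almost everywhere (all integrands are nonnegative, so
that the integrals are elements of `[0, ∞]`). -/
structure IsNonnegSolution (m : ℕ) (α : ℝ) (φ : EuclideanSpace ℝ (Fin N) → ℝ) (T : ℝ)
    (u : ℝ → EuclideanSpace ℝ (Fin N) → ℝ≥0) : Prop where
  measurable : Measurable (fun p : ℝ × EuclideanSpace ℝ (Fin N) => u p.1 p.2)
  integral_eq : ∀ᵐ p : ℝ × EuclideanSpace ℝ (Fin N), p.1 ∈ Ioo 0 T → p.2 ∈ sector N m →
    (u p.1 p.2 : ℝ≥0∞) = heatPos m p.1 (fun y => ENNReal.ofReal (φ y)) p.2 +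
      ∫⁻ s in Ioo 0 p.1, heatPos m (p.1 - s) (fun y => (u s y : ℝ≥0∞) ^ (α + 1)) p.2

/-- The maximal existence time in `[0, ∞]` of a nonnegative solution on `Ω_m` of the integral
equation with initial value `φ ≥ 0`. -/
def TmaxNonneg (m : ℕ) (α : ℝ) (φ : EuclideanSpace ℝ (Fin N) → ℝ) : ℝ≥0∞ :=
  sSup {τ | ∃ T : ℝ, 0 < T ∧ τ = ENNReal.ofReal T ∧
    ∃ u : ℝ → EuclideanSpace ℝ (Fin N) → ℝ≥0, IsNonnegSolution m α φ T u}

/-- `‖e^{Δ_m}(ω ψ₀)‖_∞`, the norm of `L^∞(Ω_m)`, as an element of `[0, ∞]`. -/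
def heatSupNorm (m : ℕ) (γ : ℝ) (ω : EuclideanSpace ℝ (Fin N) → ℝ) : ℝ≥0∞ :=
  eLpNorm (heat m 1 (fun x => ω x * psi0 m γ x)) ∞ (volume.restrict (sector N m))

/-- The bound `(α^{1/α} ‖e^{Δ_m}(ω ψ₀)‖_∞)^{-(1/α - (γ+m)/2)^{-1}}`. -/
def lifespanBound (m : ℕ) (α γ : ℝ) (ω : EuclideanSpace ℝ (Fin N) → ℝ) : ℝ≥0∞ :=
  ((ENNReal.ofReal (α ^ (1 / α)) * heatSupNorm m γ ω) ^ (1 / α - (γ + m) / 2)⁻¹)⁻¹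

end SectorHeat

end

/-! Fix a time `t` and a point `x` of the sector, and let `u` be a nonnegative solution with initial
value `φ`. Applying `e^{(t-s)Δ_m}` to the equation at time `s` gives `H(s) = (e^{(t-s)Δ_m} u(s))(x)
= (e^{tΔ_m} φ)(x) + ∫₀ˢ (e^{(t-σ)Δ_m} u(σ)^{α+1})(x) dσ`. The kernel has mass at most `1`, so Jensen
bounds the integrand below by `H(σ)^{α+1}`. Thus `H' ≥ H^{α+1}` in integrated form, and finiteness
of `u(t, x)` forces `α t ((e^{tΔ_m} φ)(x))^α ≤ 1`. This is
`IsNonnegSolution.mul_heatPos_rpow_le_one`.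

Since `ω ψ₀` is homogeneous of degree `-(γ+m)`, parabolic scaling gives `e^{tΔ_m}(ω ψ₀)(√t x) =
t^{-(γ+m)/2} e^{Δ_m}(ω ψ₀)(x)`. If the initial value is `λφ` and `c < ‖e^{Δ_m}(ω ψ₀)‖_∞`, the
necessary condition becomes `α t (λ t^{-(γ+m)/2} c)^α ≤ 1`, that is `t ≤ (λ α^{1/α} c)^{-1/κ}` with
`κ = 1/α - (γ+m)/2 > 0`. The lower bound on `φ` is only local. Cutting `ω ψ₀` off outside a large
ball keeps the supremum above `c`, and the cut-off is harmless for small `t`, the only times that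
matter as `λ → ∞` (`exists_min_le_rpow`). Letting `c` increase to the norm gives the limsup.

Regular solutions reduce to this case. In the class `|u(t)| ≤ M e^{tΔ_m} ψ₀` the negative part
satisfies a singular Gronwall inequality whose weight `s^{-α(γ+m)/2}` is integrable because `α <
2/(γ+m)`. Hence it vanishes (`IsRegularSolution.nonneg`), and `Tmax_le_TmaxNonneg` follows. -/

noncomputable section

namespace SectorHeat

variable {N : ℕ}

/-! ### The one-dimensional heat kernels -/

/-- The Gaussian heat kernel of the line. -/
def gauss (t z : ℝ) : ℝ := (4 * Real.pi * t) ^ (-(1 / 2) : ℝ) * Real.exp (-z ^ 2 / (4 * t))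

lemma gauss_pos {t : ℝ} (ht : 0 < t) (z : ℝ) : 0 < gauss t z := by
  unfold gauss; positivity

lemma gauss_neg (t z : ℝ) : gauss t (-z) = gauss t z := by simp [gauss]

lemma gauss_lt_gauss {t a b : ℝ} (ht : 0 < t) (hab : a ^ 2 < b ^ 2) : gauss t b < gauss t a := by
  unfold gauss
  have : 0 < (4 * Real.pi * t) ^ (-(1 / 2) : ℝ) := by positivity
  gcongr

lemma integrable_gauss {t : ℝ} (ht : 0 < t) : Integrable (gauss t) := by
  have h := (integrable_exp_neg_mul_sq (b := 1 / (4 * t)) (by positivity)).const_mul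
    ((4 * Real.pi * t) ^ (-(1 / 2) : ℝ))
  refine h.congr (ae_of_all _ fun z => ?_)
  simp only [gauss]
  congr 2
  ring

lemma integral_gauss {t : ℝ} (ht : 0 < t) : ∫ z, gauss t z = 1 := by
  have h : ∀ z, gauss t z
      = (4 * Real.pi * t) ^ (-(1 / 2) : ℝ) * Real.exp (-(1 / (4 * t)) * z ^ 2) := fun z => by
    simp only [gauss]; congr 2; ring
  simp_rw [h]
  rw [integral_const_mul, integral_gaussian, Real.sqrt_eq_rpow,
    show Real.pi / (1 / (4 * t)) = 4 * Real.pi * t by field_simp,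
    ← Real.rpow_add (by positivity)]
  norm_num

/-- Completing the square in `z`: what remains is one Gaussian in `z`, of total mass `1`, so the
semigroup law of the line can be read off. -/
lemma gauss_mul_gauss {t s : ℝ} (ht : 0 < t) (hs : 0 < s) (a b z : ℝ) :
    gauss t (a - z) * gauss s (z - b)
      = gauss (t + s) (a - b) * gauss (t * s / (t + s)) (z - (a * s + b * t) / (t + s)) := by
  have hc : (4 * Real.pi * t) ^ (-(1 / 2) : ℝ) * (4 * Real.pi * s) ^ (-(1 / 2) : ℝ)
      = (4 * Real.pi * (t + s)) ^ (-(1 / 2) : ℝ)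
        * (4 * Real.pi * (t * s / (t + s))) ^ (-(1 / 2) : ℝ) := by
    rw [← Real.mul_rpow (by positivity) (by positivity),
      ← Real.mul_rpow (by positivity) (by positivity)]
    congr 1
    field_simp
  have he : Real.exp (-(a - z) ^ 2 / (4 * t)) * Real.exp (-(z - b) ^ 2 / (4 * s))
      = Real.exp (-(a - b) ^ 2 / (4 * (t + s)))
        * Real.exp (-(z - (a * s + b * t) / (t + s)) ^ 2 / (4 * (t * s / (t + s)))) := by
    rw [← Real.exp_add, ← Real.exp_add]
    congr 1
    field_simp
    ring
  unfold gauss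
  rw [mul_mul_mul_comm, hc, he, mul_mul_mul_comm]

lemma integrable_gauss_mul_gauss {t s : ℝ} (ht : 0 < t) (hs : 0 < s) (a b : ℝ) :
    Integrable (fun z => gauss t (a - z) * gauss s (z - b)) := by
  simp_rw [gauss_mul_gauss ht hs]
  exact ((integrable_gauss (by positivity)).comp_sub_right _).const_mul _

lemma integral_gauss_mul_gauss {t s : ℝ} (ht : 0 < t) (hs : 0 < s) (a b : ℝ) :
    ∫ z, gauss t (a - z) * gauss s (z - b) = gauss (t + s) (a - b) := by
  simp_rw [gauss_mul_gauss ht hs]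
  rw [integral_const_mul, integral_sub_right_eq_self (fun z => gauss (t * s / (t + s)) z),
    integral_gauss (by positivity), mul_one]

/-- The Dirichlet heat kernel of the half-line, not yet restricted to it. -/
def gaussDiff (t a b : ℝ) : ℝ := gauss t (a - b) - gauss t (a + b)

lemma gaussDiff_pos {t a b : ℝ} (ht : 0 < t) (ha : 0 < a) (hb : 0 < b) : 0 < gaussDiff t a b :=
  sub_pos.2 (gauss_lt_gauss ht (by nlinarith [mul_pos ha hb]))

/-- Evenness of the Gaussian brings each of the four terms to the form `gauss t (±a - z) * gauss s
(z - ±b)`, to which the convolution formula applies. -/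
lemma gaussDiff_mul_eq (t s a b z : ℝ) :
    gaussDiff t a z * gaussDiff s z b
      = (gauss t (a - z) * gauss s (z - b) - gauss t (a - z) * gauss s (z - -b))
        - (gauss t (-a - z) * gauss s (z - b) - gauss t (-a - z) * gauss s (z - -b)) := by
  have h : gauss t (-a - z) = gauss t (a + z) := by rw [← gauss_neg]; congr 1; ring
  rw [h, sub_neg_eq_add]
  unfold gaussDiff
  ring

lemma integrable_gaussDiff_mul {t s : ℝ} (ht : 0 < t) (hs : 0 < s) (a b : ℝ) :
    Integrable (fun z => gaussDiff t a z * gaussDiff s z b) := by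
  simp_rw [gaussDiff_mul_eq]
  have h := integrable_gauss_mul_gauss ht hs
  exact ((h _ _).sub (h _ _)).sub ((h _ _).sub (h _ _))

/-- The integrand is even in `z`, being a product of two odd functions, so the half-line carries
half of the integral over the line. The four convolutions there add up to twice the kernel. -/
lemma setIntegral_gaussDiff_mul {t s : ℝ} (ht : 0 < t) (hs : 0 < s) (a b : ℝ) :
    ∫ z in Ioi 0, gaussDiff t a z * gaussDiff s z b = gaussDiff (t + s) a b := by
  have hodd : ∀ z, gaussDiff t a (-z) * gaussDiff s (-z) b
      = gaussDiff t a z * gaussDiff s z b := fun z => by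
    have h1 : gauss s (-z - b) = gauss s (z + b) := by rw [← gauss_neg]; congr 1; ring
    have h2 : gauss s (-z + b) = gauss s (z - b) := by rw [← gauss_neg]; congr 1; ring
    simp only [gaussDiff, h1, h2, sub_neg_eq_add, ← sub_eq_add_neg]
    ring
  have habs : ∀ z : ℝ, gaussDiff t a |z| * gaussDiff s |z| b
      = gaussDiff t a z * gaussDiff s z b := fun z => by
    rcases abs_choice z with h | h <;> rw [h]
    exact hodd z
  have h2 := integral_comp_abs (f := fun z => gaussDiff t a z * gaussDiff s z b)
  simp_rw [habs] at h2
  have hi := integrable_gauss_mul_gauss ht hs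
  have hv := integral_gauss_mul_gauss ht hs
  have h3 : ∫ z, gaussDiff t a z * gaussDiff s z b = 2 * gaussDiff (t + s) a b := by
    simp_rw [gaussDiff_mul_eq]
    have hi2 : ∀ a, Integrable fun z =>
        gauss t (a - z) * gauss s (z - b) - gauss t (a - z) * gauss s (z - -b) := fun a =>
      (hi _ _).sub (hi _ _)
    rw [integral_sub (hi2 _) (hi2 _), integral_sub (hi _ _) (hi _ _), integral_sub (hi _ _) (hi _ _), hv, hv, hv, hv]
    have h1 : gauss (t + s) (-a - b) = gauss (t + s) (a + b) := by
      rw [← gauss_neg]; congr 1; ring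
    have h2 : gauss (t + s) (-a - -b) = gauss (t + s) (a - b) := by
      rw [← gauss_neg]; congr 1; ring
    rw [h1, h2]
    unfold gaussDiff
    rw [sub_neg_eq_add]
    ring
  linarith

/-- The factor of the heat kernel of the sector that belongs to one coordinate: the Dirichlet heat
kernel of the half-line (extended by zero) if `p` holds, and the heat kernel of the line if not. -/
def factor (p : Prop) [Decidable p] (t a b : ℝ) : ℝ :=
  if p then (Ioi (0 : ℝ)).indicator (gaussDiff t a) b else gauss t (a - b)

section factor

variable (p : Prop) [Decidable p]

lemma factor_nonneg {t a : ℝ} (ht : 0 < t) (ha : p → 0 < a) (b : ℝ) : 0 ≤ factor p t a b := by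
  unfold factor
  split_ifs with h
  · exact indicator_nonneg (fun b hb => (gaussDiff_pos ht (ha h) hb).le) b
  · exact (gauss_pos ht _).le

lemma integrable_factor {t : ℝ} (ht : 0 < t) (a : ℝ) : Integrable (factor p t a) := by
  have h1 := (integrable_gauss ht).comp_sub_left a
  have h2 := (integrable_gauss ht).comp_add_left a
  unfold factor
  split_ifs
  · exact (h1.sub h2).indicator measurableSet_Ioi
  · exact h1

lemma integral_factor_le_one {t a : ℝ} (ht : 0 < t) :
    ∫ b, factor p t a b ≤ 1 := by
  have h1 := (integrable_gauss ht).comp_sub_left a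
  calc ∫ b, factor p t a b ≤ ∫ b, gauss t (a - b) := by
        refine integral_mono (integrable_factor p ht a) h1 fun b => ?_
        simp only [factor]
        split_ifs
        · refine indicator_le' (fun b _ => ?_) (fun b _ => (gauss_pos ht _).le) b
          exact sub_le_self _ (gauss_pos ht _).le
        · exact le_rfl
    _ = 1 := by rw [integral_sub_left_eq_self (gauss t), integral_gauss ht]

lemma integrable_factor_mul {t s : ℝ} (ht : 0 < t) (hs : 0 < s) (a b : ℝ) :
    Integrable (fun z => factor p t a z * factor p s z b) := by
  unfold factor
  split_ifs
  · by_cases hb : b ∈ Ioi (0 : ℝ)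
    · simp only [indicator_of_mem hb]
      refine ((integrable_gaussDiff_mul ht hs a b).indicator (measurableSet_Ioi (a := 0))).congr
        (ae_of_all _ fun z => ?_)
      simp only [indicator_apply]
      split_ifs <;> simp
    · simp [indicator_of_notMem hb]
  · exact integrable_gauss_mul_gauss ht hs a b

lemma integral_factor_mul {t s : ℝ} (ht : 0 < t) (hs : 0 < s) (a b : ℝ) :
    ∫ z, factor p t a z * factor p s z b = factor p (t + s) a b := by
  unfold factor
  split_ifs
  · by_cases hb : b ∈ Ioi (0 : ℝ)
    · simp only [indicator_of_mem hb]
      rw [← setIntegral_gaussDiff_mul ht hs, ← integral_indicator measurableSet_Ioi]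
      refine integral_congr_ae (ae_of_all _ fun z => ?_)
      simp only [indicator_apply]
      split_ifs <;> simp
    · simp [indicator_of_notMem hb]
  · exact integral_gauss_mul_gauss ht hs a b

end factor

/-! ### Product structure -/

lemma lintegral_prod_ofReal {f : Fin N → ℝ → ℝ} (hf : ∀ i, Integrable (f i))
    (h0 : ∀ i z, 0 ≤ f i z) :
    ∫⁻ y : EuclideanSpace ℝ (Fin N), ENNReal.ofReal (∏ i, f i (y i))
      = ENNReal.ofReal (∏ i, ∫ z, f i z) := by
  have h := ofReal_integral_eq_lintegral_ofReal (μ := (volume : Measure (Fin N → ℝ)))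
    (Integrable.fintype_prod hf) (ae_of_all _ fun y => Finset.prod_nonneg fun i _ => h0 i _)
  rw [← integral_fintype_prod_volume_eq_prod, h]
  exact (EuclideanSpace.volume_preserving_symm_measurableEquiv_toLp (Fin N)).lintegral_comp_emb
    (MeasurableEquiv.measurableEmbedding _) fun y => ENNReal.ofReal (∏ i, f i (y i))

lemma measurableSet_sector (m : ℕ) : MeasurableSet (sector N m) := by
  have : sector N m = ⋂ i : Fin N, {x | (i : ℕ) < m → 0 < x i} := by
    ext x; simp [sector]
  rw [this]
  refine MeasurableSet.iInter fun i => ?_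
  by_cases h : (i : ℕ) < m
  · simp only [h, true_imp_iff]
    exact measurableSet_lt measurable_const (by fun_prop)
  · simp [h]

lemma kernel_eq_prod (m : ℕ) {t : ℝ} (ht : 0 < t) (x y : EuclideanSpace ℝ (Fin N)) :
    kernel m t x y
      = ∏ i : Fin N, if (i : ℕ) < m then gaussDiff t (x i) (y i) else gauss t (x i - y i) := by
  have hc : (4 * Real.pi * t) ^ (-(N : ℝ) / 2)
      = ∏ _i : Fin N, (4 * Real.pi * t) ^ (-(1 / 2) : ℝ) := by
    rw [Finset.prod_const, Finset.card_univ, Fintype.card_fin, ← Real.rpow_natCast,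
      ← Real.rpow_mul (by positivity)]
    congr 1; ring
  rw [kernel, hc, ← Finset.prod_mul_distrib]
  refine Finset.prod_congr rfl fun i _ => ?_
  split_ifs
  · simp only [gaussDiff, gauss]; ring
  · rfl

/-- Extension by zero makes the sector kernel a product over coordinates on all of `ℝ^N`, so
integrals over the sector split into one-dimensional ones. -/
lemma indicator_kernel (m : ℕ) {t : ℝ} (ht : 0 < t) (x y : EuclideanSpace ℝ (Fin N)) :
    (sector N m).indicator (kernel m t x) y = ∏ i : Fin N, factor ((i : ℕ) < m) t (x i) (y i) := by
  by_cases hy : y ∈ sector N m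
  · rw [indicator_of_mem hy, kernel_eq_prod m ht]
    refine Finset.prod_congr rfl fun i _ => ?_
    unfold factor
    split_ifs with h
    · rw [indicator_of_mem (show y i ∈ Ioi (0 : ℝ) from hy i h)]
    · rfl
  · rw [indicator_of_notMem hy]
    simp only [sector, mem_ofPred_eq, not_forall] at hy
    obtain ⟨i, hi, hyi⟩ := hy
    refine (Finset.prod_eq_zero (Finset.mem_univ i) ?_).symm
    rw [factor, if_pos hi, indicator_of_notMem (show y i ∉ Ioi (0 : ℝ) from hyi)]

lemma kernel_pos (m : ℕ) {t : ℝ} (ht : 0 < t) {x y : EuclideanSpace ℝ (Fin N)}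
    (hx : x ∈ sector N m) (hy : y ∈ sector N m) : 0 < kernel m t x y := by
  rw [kernel_eq_prod m ht]
  refine Finset.prod_pos fun i _ => ?_
  split_ifs with h
  · exact gaussDiff_pos ht (hx i h) (hy i h)
  · exact gauss_pos ht _

lemma setLIntegral_kernel_eq (m : ℕ) {t : ℝ} (x : EuclideanSpace ℝ (Fin N))
    (g : EuclideanSpace ℝ (Fin N) → ℝ≥0∞) :
    ∫⁻ y in sector N m, ENNReal.ofReal (kernel m t x y) * g y
      = ∫⁻ y, ENNReal.ofReal ((sector N m).indicator (kernel m t x) y) * g y := by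
  rw [← lintegral_indicator (measurableSet_sector m)]
  refine lintegral_congr fun y => ?_
  by_cases hy : y ∈ sector N m <;> simp [hy]

lemma lintegral_kernel_le_one (m : ℕ) {t : ℝ} (ht : 0 < t) {x : EuclideanSpace ℝ (Fin N)}
    (hx : x ∈ sector N m) :
    ∫⁻ y in sector N m, ENNReal.ofReal (kernel m t x y) ≤ 1 := by
  have h := setLIntegral_kernel_eq m (t := t) x 1
  simp only [Pi.one_apply, mul_one] at h
  rw [h]
  simp_rw [indicator_kernel m ht]
  rw [lintegral_prod_ofReal (fun i => integrable_factor _ ht _)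
    (fun i z => factor_nonneg _ ht (fun h => hx i h) z)]
  refine ENNReal.ofReal_le_one.2 (Finset.prod_le_one (fun i _ => ?_) fun i _ => ?_)
  · exact integral_nonneg fun z => factor_nonneg _ ht (fun h => hx i h) z
  · exact integral_factor_le_one _ ht

lemma lintegral_kernel_mul_kernel (m : ℕ) {t s : ℝ} (ht : 0 < t) (hs : 0 < s)
    {x y : EuclideanSpace ℝ (Fin N)} (hx : x ∈ sector N m) (hy : y ∈ sector N m) :
    ∫⁻ z in sector N m, ENNReal.ofReal (kernel m t x z) * ENNReal.ofReal (kernel m s z y)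
      = ENNReal.ofReal (kernel m (t + s) x y) := by
  rw [setLIntegral_kernel_eq]
  have key : ∀ z : EuclideanSpace ℝ (Fin N),
      ENNReal.ofReal ((sector N m).indicator (kernel m t x) z) * ENNReal.ofReal (kernel m s z y)
      = ENNReal.ofReal (∏ i : Fin N,
          factor ((i : ℕ) < m) t (x i) (z i) * factor ((i : ℕ) < m) s (z i) (y i)) := fun z => by
    rw [Finset.prod_mul_distrib, ← indicator_kernel m ht, ← indicator_kernel m hs,
      indicator_of_mem hy]
    refine (ENNReal.ofReal_mul ?_).symm
    exact indicator_nonneg (fun z hz => (kernel_pos m ht hx hz).le) z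
  simp_rw [key]
  rw [lintegral_prod_ofReal (f := fun i z => factor ((i : ℕ) < m) t (x i) z
      * factor ((i : ℕ) < m) s z (y i)) (fun i => integrable_factor_mul _ ht hs _ _)]
  · simp_rw [integral_factor_mul _ ht hs]
    rw [← indicator_kernel m (add_pos ht hs), indicator_of_mem hy]
  -- In a half-line coordinate the second factor may be negative for `z ≤ 0`, but there the first
  -- factor vanishes.
  · intro i z
    by_cases h : (i : ℕ) < m
    · by_cases hz : 0 < z
      · exact mul_nonneg (factor_nonneg _ ht (fun h => hx i h) z)
          (factor_nonneg _ hs (fun _ => hz) _)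
      · simp [factor, h, hz]
    · exact mul_nonneg (factor_nonneg _ ht (fun h => hx i h) z)
        (factor_nonneg _ hs (fun h' => absurd h' h) _)

/-! ### The heat semigroup on functions with values in `[0, ∞]` -/

lemma measurable_kernel (m : ℕ) :
    Measurable fun p : ℝ × EuclideanSpace ℝ (Fin N) × EuclideanSpace ℝ (Fin N) =>
      kernel m p.1 p.2.1 p.2.2 := by
  unfold kernel
  refine Measurable.mul (by fun_prop) (Finset.measurable_prod _ fun i _ => ?_)
  split_ifs <;> fun_prop

lemma measurable_kernel_right (m : ℕ) (t : ℝ) (x : EuclideanSpace ℝ (Fin N)) :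
    Measurable (kernel m t x) :=
  (measurable_kernel m).comp (by fun_prop : Measurable fun y => (t, x, y))

lemma measurable_heatPos {δ : Type*} [MeasurableSpace δ] (m : ℕ) {τ : δ → ℝ}
    {ξ : δ → EuclideanSpace ℝ (Fin N)} {F : δ → EuclideanSpace ℝ (Fin N) → ℝ≥0∞}
    (hτ : Measurable τ) (hξ : Measurable ξ) (hF : Measurable (Function.uncurry F)) :
    Measurable fun d => heatPos m (τ d) (F d) (ξ d) := by
  unfold heatPos
  refine Measurable.lintegral_prod_right
    (f := fun d y => ENNReal.ofReal (kernel m (τ d) (ξ d) y) * F d y) ?_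
  refine Measurable.mul (Measurable.ennreal_ofReal ?_) hF
  exact (measurable_kernel m).comp
    (by fun_prop : Measurable fun p : δ × EuclideanSpace ℝ (Fin N) => (τ p.1, ξ p.1, p.2))

lemma heatPos_mono_ae (m : ℕ) (t : ℝ) {f g : EuclideanSpace ℝ (Fin N) → ℝ≥0∞}
    (h : ∀ᵐ y, y ∈ sector N m → f y ≤ g y) (x : EuclideanSpace ℝ (Fin N)) :
    heatPos m t f x ≤ heatPos m t g x := by
  refine lintegral_mono_ae ?_
  filter_upwards [(ae_restrict_iff' (measurableSet_sector m)).2 h] with y hy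
  gcongr

lemma heatPos_congr_ae (m : ℕ) (t : ℝ) {f g : EuclideanSpace ℝ (Fin N) → ℝ≥0∞}
    (h : ∀ᵐ y, y ∈ sector N m → f y = g y) (x : EuclideanSpace ℝ (Fin N)) :
    heatPos m t f x = heatPos m t g x :=
  le_antisymm (heatPos_mono_ae m t (h.mono fun _ hy hs => (hy hs).le) x)
    (heatPos_mono_ae m t (h.mono fun _ hy hs => (hy hs).ge) x)

lemma heatPos_const_mul (m : ℕ) (t : ℝ) {c : ℝ≥0∞} (hc : c ≠ ∞)
    (f : EuclideanSpace ℝ (Fin N) → ℝ≥0∞) (x : EuclideanSpace ℝ (Fin N)) :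
    heatPos m t (fun y => c * f y) x = c * heatPos m t f x := by
  unfold heatPos
  rw [← lintegral_const_mul' _ _ hc]
  exact lintegral_congr fun y => by ring

lemma heatPos_add_right (m : ℕ) (t : ℝ) (f : EuclideanSpace ℝ (Fin N) → ℝ≥0∞)
    {g : EuclideanSpace ℝ (Fin N) → ℝ≥0∞} (hg : Measurable g) (x : EuclideanSpace ℝ (Fin N)) :
    heatPos m t (fun y => f y + g y) x = heatPos m t f x + heatPos m t g x := by
  unfold heatPos
  simp_rw [mul_add]
  exact lintegral_add_right _ ((measurable_kernel_right m t x).ennreal_ofReal.mul hg)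

lemma heatPos_lintegral (m : ℕ) (t : ℝ) (S : Set ℝ) {F : ℝ → EuclideanSpace ℝ (Fin N) → ℝ≥0∞}
    (hF : Measurable (Function.uncurry F)) (x : EuclideanSpace ℝ (Fin N)) :
    heatPos m t (fun y => ∫⁻ s in S, F s y) x = ∫⁻ s in S, heatPos m t (F s) x := by
  have hk := (measurable_kernel_right m t x).ennreal_ofReal
  unfold heatPos
  rw [lintegral_lintegral_swap]
  · refine lintegral_congr fun y => (lintegral_const_mul _ ?_).symm
    exact hF.comp (by fun_prop : Measurable fun s : ℝ => (s, y))
  · refine Measurable.aemeasurable (Measurable.mul (hk.comp measurable_snd) hF)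

lemma heatPos_heatPos (m : ℕ) {t s : ℝ} (ht : 0 < t) (hs : 0 < s)
    {f : EuclideanSpace ℝ (Fin N) → ℝ≥0∞} (hf : AEMeasurable f (volume.restrict (sector N m)))
    {x : EuclideanSpace ℝ (Fin N)} (hx : x ∈ sector N m) :
    heatPos m t (heatPos m s f) x = heatPos m (t + s) f x := by
  have hfg : ∀ᵐ y, y ∈ sector N m → f y = hf.mk f y :=
    (ae_restrict_iff' (measurableSet_sector m)).1 hf.ae_eq_mk
  have hg := hf.measurable_mk
  generalize hf.mk f = g at hfg hg
  rw [funext (heatPos_congr_ae m s hfg), heatPos_congr_ae m (t + s) hfg]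
  have hk : Measurable fun p : EuclideanSpace ℝ (Fin N) × EuclideanSpace ℝ (Fin N) =>
      kernel m s p.2 p.1 := (measurable_kernel m).comp
    (by fun_prop : Measurable fun p : EuclideanSpace ℝ (Fin N) × EuclideanSpace ℝ (Fin N) =>
      (s, p.2, p.1))
  have hkt := (measurable_kernel_right m t x).ennreal_ofReal
  calc heatPos m t (heatPos m s g) x
      = ∫⁻ z in sector N m, ∫⁻ y in sector N m, ENNReal.ofReal (kernel m t x z)
          * (ENNReal.ofReal (kernel m s z y) * g y) := by
        unfold heatPos
        refine lintegral_congr fun z => (lintegral_const_mul _ ?_).symm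
        exact (measurable_kernel_right m s z).ennreal_ofReal.mul hg
    _ = ∫⁻ y in sector N m, ∫⁻ z in sector N m, ENNReal.ofReal (kernel m t x z)
          * (ENNReal.ofReal (kernel m s z y) * g y) := by
        refine lintegral_lintegral_swap (Measurable.aemeasurable ?_)
        refine (hkt.comp measurable_fst).mul (Measurable.mul ?_ (hg.comp measurable_snd))
        exact (hk.comp measurable_swap).ennreal_ofReal
    _ = ∫⁻ y in sector N m, (∫⁻ z in sector N m, ENNReal.ofReal (kernel m t x z)
          * ENNReal.ofReal (kernel m s z y)) * g y := by
        refine lintegral_congr fun y => ?_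
        rw [← lintegral_mul_const]
        · exact lintegral_congr fun z => by ring
        · exact hkt.mul (hk.comp (by fun_prop : Measurable fun z => (y, z))).ennreal_ofReal
    _ = heatPos m (t + s) g x := by
        refine setLIntegral_congr_fun (measurableSet_sector m) fun y hy => ?_
        simp only [lintegral_kernel_mul_kernel m ht hs hx hy]

lemma heatPos_const_le (m : ℕ) {t : ℝ} (ht : 0 < t) (c : ℝ≥0∞) {x : EuclideanSpace ℝ (Fin N)}
    (hx : x ∈ sector N m) : heatPos m t (fun _ => c) x ≤ c := by
  unfold heatPos
  rw [lintegral_mul_const _ (measurable_kernel_right m t x).ennreal_ofReal]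
  exact mul_le_of_le_one_left' (lintegral_kernel_le_one m ht hx)

/-- Jensen's inequality for the sub-Markovian heat kernel of the sector. -/
lemma heatPos_rpow_le (m : ℕ) {t α : ℝ} (ht : 0 < t) (hα : 0 < α)
    {f : EuclideanSpace ℝ (Fin N) → ℝ≥0∞} (hf : Measurable f)
    {x : EuclideanSpace ℝ (Fin N)} (hx : x ∈ sector N m) :
    heatPos m t f x ^ (α + 1) ≤ heatPos m t (fun y => f y ^ (α + 1)) x := by
  have hk := (measurable_kernel_right m t x).ennreal_ofReal
  set μ := (volume.restrict (sector N m)).withDensity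
    fun y => ENNReal.ofReal (kernel m t x y) with hμ
  have hμ1 : μ univ ≤ 1 := by
    rw [hμ, withDensity_apply _ MeasurableSet.univ, Measure.restrict_univ]
    exact lintegral_kernel_le_one m ht hx
  have heq : ∀ g : EuclideanSpace ℝ (Fin N) → ℝ≥0∞, Measurable g →
      heatPos m t g x = ∫⁻ y, g y ∂μ := fun g hg => by
    rw [hμ, lintegral_withDensity_eq_lintegral_mul _ hk hg]
    rfl
  -- Hölder's inequality against the measure `kernel m t x y dy`; the resulting power of the total
  -- mass is at most `1`.
  have h := eLpNorm'_le_eLpNorm'_mul_rpow_measure_univ (μ := μ) (f := f) (p := 1) (q := α + 1)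
    one_pos (by linarith) hf.aestronglyMeasurable
  have h2 : ∫⁻ y, f y ∂μ ≤ (∫⁻ y, f y ^ (α + 1) ∂μ) ^ (1 / (α + 1)) := by
    refine le_trans (le_of_eq (by simp [eLpNorm'])) (h.trans ?_)
    refine (mul_le_of_le_one_right' (ENNReal.rpow_le_one hμ1 ?_)).trans
      (le_of_eq (by simp [eLpNorm']))
    rw [sub_nonneg]
    exact one_div_le_one_div_of_le one_pos (by linarith)
  rw [heq _ hf, heq _ (hf.pow_const _)]
  calc _ ≤ ((∫⁻ y, f y ^ (α + 1) ∂μ) ^ (1 / (α + 1))) ^ (α + 1) := by gcongr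
    _ = _ := by rw [← ENNReal.rpow_mul, one_div_mul_cancel (by linarith), ENNReal.rpow_one]

lemma smul_mem_sector {m : ℕ} {r : ℝ} (hr : 0 < r) {x : EuclideanSpace ℝ (Fin N)} :
    r • x ∈ sector N m ↔ x ∈ sector N m := by
  simp [sector, hr]

lemma kernel_smul (m : ℕ) {r t : ℝ} (hr : 0 < r) (ht : 0 < t) (x y : EuclideanSpace ℝ (Fin N)) :
    kernel m (r ^ 2 * t) (r • x) (r • y) = (r ^ N)⁻¹ * kernel m t x y := by
  have hc : (4 * Real.pi * (r ^ 2 * t)) ^ (-(N : ℝ) / 2)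
      = (r ^ N)⁻¹ * (4 * Real.pi * t) ^ (-(N : ℝ) / 2) := by
    rw [show 4 * Real.pi * (r ^ 2 * t) = r ^ 2 * (4 * Real.pi * t) by ring,
      Real.mul_rpow (by positivity) (by positivity), ← Real.rpow_natCast r 2,
      ← Real.rpow_mul hr.le, ← Real.rpow_natCast r N, ← Real.rpow_neg hr.le]
    congr 2
    push_cast
    ring
  unfold kernel
  rw [hc, mul_assoc]
  congr 2
  refine Finset.prod_congr rfl fun i _ => ?_
  have he : ∀ z : ℝ, -(r * z) ^ 2 / (4 * (r ^ 2 * t)) = -z ^ 2 / (4 * t) := fun z => by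
    field_simp
  simp only [PiLp.smul_apply, smul_eq_mul, ← mul_sub, ← mul_add, he]

lemma heatPos_smul (m : ℕ) {r t : ℝ} (hr : 0 < r) (ht : 0 < t)
    (f : EuclideanSpace ℝ (Fin N) → ℝ≥0∞) (x : EuclideanSpace ℝ (Fin N)) :
    heatPos m (r ^ 2 * t) f (r • x) = heatPos m t (fun y => f (r • y)) x := by
  have hS := measurableSet_sector (N := N) m
  have hmap := Measure.map_addHaar_smul (volume : Measure (EuclideanSpace ℝ (Fin N))) hr.ne'
  have hemb : MeasurableEmbedding fun y : EuclideanSpace ℝ (Fin N) => r • y :=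
    measurableEmbedding_const_smul₀ hr.ne'
  set G : EuclideanSpace ℝ (Fin N) → ℝ≥0∞ := (sector N m).indicator
    fun y => ENNReal.ofReal (kernel m (r ^ 2 * t) (r • x) y) * f y with hG
  have h1 : heatPos m (r ^ 2 * t) f (r • x) = ∫⁻ y, G y := (lintegral_indicator hS _).symm
  have h2 : ∫⁻ y, G (r • y) = ENNReal.ofReal (r ^ N)⁻¹ * ∫⁻ y, G y := by
    rw [← hemb.lintegral_map, hmap, lintegral_smul_measure, finrank_euclideanSpace_fin,
      abs_of_pos (by positivity), smul_eq_mul]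
  have h3 : ∫⁻ y, G (r • y) = ENNReal.ofReal (r ^ N)⁻¹ * heatPos m t (fun y => f (r • y)) x := by
    rw [heatPos, ← lintegral_const_mul' _ _ ENNReal.ofReal_ne_top, ← lintegral_indicator hS]
    refine lintegral_congr fun y => ?_
    by_cases hy : y ∈ sector N m
    · rw [hG, indicator_of_mem ((smul_mem_sector hr).2 hy), indicator_of_mem hy,
        kernel_smul m hr ht, ENNReal.ofReal_mul (by positivity), mul_assoc]
    · rw [hG, indicator_of_notMem (mt (smul_mem_sector hr).1 hy), indicator_of_notMem hy]
  rw [h1]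
  -- Both `h2` and `h3` evaluate `∫⁻ y, G (r • y)`: the Jacobian and the scaling of the kernel give
  -- the same factor `r^{-N}`, which cancels.
  refine (ENNReal.mul_right_inj ?_ ENNReal.ofReal_ne_top).1 (h2.symm.trans h3)
  exact (ENNReal.ofReal_pos.2 (by positivity)).ne'

/-! ### Comparison with the Bochner integral -/

/-- No integrability is needed, since the Bochner integral of a non-integrable function is `0` by
convention. -/
lemma ofReal_integral_le {δ : Type*} [MeasurableSpace δ] (μ : Measure δ) (f : δ → ℝ) :
    ENNReal.ofReal (∫ x, f x ∂μ) ≤ ∫⁻ x, ENNReal.ofReal (f x) ∂μ := by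
  by_cases hf : Integrable f μ
  · rw [integral_eq_lintegral_pos_part_sub_lintegral_neg_part hf]
    refine (ENNReal.ofReal_le_ofReal (sub_le_self _ ENNReal.toReal_nonneg)).trans ?_
    exact ENNReal.ofReal_toReal_le
  · simp [integral_undef hf]

lemma ofReal_heat_le (m : ℕ) {t : ℝ} (ht : 0 < t) (f : EuclideanSpace ℝ (Fin N) → ℝ)
    {x : EuclideanSpace ℝ (Fin N)} (hx : x ∈ sector N m) :
    ENNReal.ofReal (heat m t f x) ≤ heatPos m t (fun y => ENNReal.ofReal (f y)) x := by
  refine (ofReal_integral_le _ _).trans (le_of_eq ?_)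
  exact setLIntegral_congr_fun (measurableSet_sector m) fun y hy =>
    ENNReal.ofReal_mul (kernel_pos m ht hx hy).le

lemma heat_eq_toReal (m : ℕ) {t : ℝ} (ht : 0 < t) {f : EuclideanSpace ℝ (Fin N) → ℝ}
    (hf : AEStronglyMeasurable f (volume.restrict (sector N m)))
    (h0 : ∀ᵐ y, y ∈ sector N m → 0 ≤ f y)
    {x : EuclideanSpace ℝ (Fin N)} (hx : x ∈ sector N m) :
    heat m t f x = (heatPos m t (fun y => ENNReal.ofReal (f y)) x).toReal := by
  unfold heat heatPos
  rw [integral_eq_lintegral_of_nonneg_ae]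
  · congr 1
    exact setLIntegral_congr_fun (measurableSet_sector m) fun y hy =>
      ENNReal.ofReal_mul (kernel_pos m ht hx hy).le
  · filter_upwards [(ae_restrict_iff' (measurableSet_sector m)).2 h0,
      ae_restrict_mem (measurableSet_sector m)] with y hy hys
    exact mul_nonneg (kernel_pos m ht hx hys).le hy
  · exact (measurable_kernel_right m t x).aestronglyMeasurable.mul hf

/-! ### The weight `ψ₀` -/

/-- The monomial `x_1 ⋯ x_m`. -/
def coordProd (m : ℕ) (x : EuclideanSpace ℝ (Fin N)) : ℝ :=
  ∏ i : Fin N, if (i : ℕ) < m then x i else 1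

/-- The constant `γ (γ + 2) ⋯ (γ + 2m - 2)`. -/
def psiConst (m : ℕ) (γ : ℝ) : ℝ := ∏ j ∈ Finset.range m, (γ + 2 * (j : ℝ))

lemma psi0_eq (m : ℕ) (γ : ℝ) (x : EuclideanSpace ℝ (Fin N)) :
    psi0 m γ x = psiConst m γ * coordProd m x * ‖x‖ ^ (-γ - 2 * (m : ℝ)) := rfl

lemma psiConst_pos (m : ℕ) {γ : ℝ} (hγ : 0 < γ) : 0 < psiConst m γ :=
  Finset.prod_pos fun _ _ => by positivity

lemma prod_ite_lt_const {m : ℕ} (hmN : m ≤ N) (c : ℝ) :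
    (∏ i : Fin N, if (i : ℕ) < m then c else 1) = c ^ m := by
  rw [Finset.prod_ite, Finset.prod_const, Finset.prod_const_one, mul_one, Fin.card_filter_val_lt,
    min_eq_right hmN]

lemma coordProd_pos {m : ℕ} {x : EuclideanSpace ℝ (Fin N)} (hx : x ∈ sector N m) :
    0 < coordProd m x := by
  refine Finset.prod_pos fun i _ => ?_
  split_ifs with h
  · exact hx i h
  · exact one_pos

lemma coordProd_le {m : ℕ} (hmN : m ≤ N) {x : EuclideanSpace ℝ (Fin N)} (hx : x ∈ sector N m) :
    coordProd m x ≤ ‖x‖ ^ m := by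
  rw [← prod_ite_lt_const hmN]
  refine Finset.prod_le_prod (fun i _ => ?_) fun i _ => ?_
  · split_ifs with h
    · exact (hx i h).le
    · exact zero_le_one
  · split_ifs with h
    · exact (le_abs_self _).trans (PiLp.norm_apply_le x i)
    · exact le_rfl

lemma coordProd_smul {m : ℕ} (hmN : m ≤ N) (r : ℝ) (x : EuclideanSpace ℝ (Fin N)) :
    coordProd m (r • x) = r ^ m * coordProd m x := by
  rw [← prod_ite_lt_const hmN, coordProd, coordProd, ← Finset.prod_mul_distrib]
  refine Finset.prod_congr rfl fun i _ => ?_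
  split_ifs <;> simp

lemma norm_pos_of_mem_sector {m : ℕ} (hm : 1 ≤ m) (hmN : m ≤ N) {x : EuclideanSpace ℝ (Fin N)}
    (hx : x ∈ sector N m) : 0 < ‖x‖ := by
  have h := hx ⟨0, by omega⟩ (Nat.lt_of_lt_of_le one_pos hm)
  refine norm_pos_iff.2 fun h0 => ?_
  simp [h0] at h

lemma measurable_psi0 (m : ℕ) (γ : ℝ) : Measurable (psi0 (N := N) m γ) := by
  unfold psi0
  refine Measurable.mul (measurable_const.mul (Finset.measurable_prod _ fun i _ => ?_))
    (by fun_prop)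
  split_ifs <;> fun_prop

lemma psi0_pos {m : ℕ} {γ : ℝ} (hm : 1 ≤ m) (hmN : m ≤ N) (hγ : 0 < γ)
    {x : EuclideanSpace ℝ (Fin N)} (hx : x ∈ sector N m) : 0 < psi0 m γ x := by
  have := norm_pos_of_mem_sector hm hmN hx
  have := coordProd_pos hx
  have := psiConst_pos m hγ
  rw [psi0_eq]
  positivity

lemma psi0_smul {m : ℕ} (γ : ℝ) (hmN : m ≤ N) {r : ℝ} (hr : 0 < r)
    (x : EuclideanSpace ℝ (Fin N)) : psi0 m γ (r • x) = r ^ (-(γ + m)) * psi0 m γ x := by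
  have h : r ^ (-(γ + m)) = r ^ m * r ^ (-γ - 2 * (m : ℝ)) := by
    rw [← Real.rpow_natCast, ← Real.rpow_add hr]
    congr 1
    ring
  rw [psi0_eq, psi0_eq, coordProd_smul hmN, norm_smul, Real.norm_eq_abs, abs_of_pos hr,
    Real.mul_rpow hr.le (norm_nonneg _), h]
  ring

/-! ### Bounds for `e^{tΔ_m} ψ₀`. -/

lemma gauss_one_le (z : ℝ) : gauss 1 z ≤ 1 := by
  unfold gauss
  refine mul_le_one₀ ?_ (Real.exp_nonneg _) ?_
  · exact Real.rpow_le_one_of_one_le_of_nonpos (by nlinarith [Real.pi_gt_three]) (by norm_num)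
  · exact Real.exp_le_one_iff.2 (by nlinarith [sq_nonneg z])

/-- The kernel vanishes linearly at the boundary, uniformly in `a`. For `b ≤ 1` it equals `gauss 1
(a - b) * (1 - e^{-ab}) ≤ gauss 1 (a - b) * a * b`, and the Gaussian absorbs the factor `a`. -/
lemma gaussDiff_one_le {a b : ℝ} (ha : 0 < a) (hb : 0 < b) : gaussDiff 1 a b ≤ 2 * b := by
  rcases le_or_gt 1 b with h | h
  · have := gauss_one_le (a - b)
    have := gauss_pos one_pos (a + b)
    unfold gaussDiff
    linarith
  have h1 : gauss 1 (a + b) = gauss 1 (a - b) * Real.exp (-(a * b)) := by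
    unfold gauss
    rw [mul_assoc (_ ^ _), ← Real.exp_add]
    congr 2
    ring
  have h2 : gaussDiff 1 a b ≤ gauss 1 (a - b) * (a * b) := by
    rw [gaussDiff, h1]
    have := Real.add_one_le_exp (-(a * b))
    nlinarith [gauss_pos one_pos (a - b)]
  have h3 : gauss 1 (a - b) ≤ Real.exp (-(a - b) ^ 2 / 4) := by
    unfold gauss
    rw [mul_one, mul_one]
    refine mul_le_of_le_one_left (Real.exp_nonneg _) ?_
    exact Real.rpow_le_one_of_one_le_of_nonpos (by nlinarith [Real.pi_gt_three]) (by norm_num)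
  -- With `d = a - b` and `b < 1`: `2 e^{d²/4} ≥ 2 + d²/2 ≥ d + 3/2 ≥ a`.
  have h4 : a ≤ 2 * Real.exp ((a - b) ^ 2 / 4) := by
    have := Real.add_one_le_exp ((a - b) ^ 2 / 4)
    nlinarith [sq_nonneg (a - b - 1)]
  have h5 : Real.exp (-(a - b) ^ 2 / 4) * Real.exp ((a - b) ^ 2 / 4) = 1 := by
    rw [← Real.exp_add]
    simp [neg_div]
  have h6 : gauss 1 (a - b) * a ≤ 2 := by
    calc gauss 1 (a - b) * a
        ≤ Real.exp (-(a - b) ^ 2 / 4) * (2 * Real.exp ((a - b) ^ 2 / 4)) := by gcongr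
      _ = 2 := by rw [mul_left_comm, h5, mul_one]
  nlinarith

lemma kernel_one_le {m : ℕ} (hmN : m ≤ N) {x y : EuclideanSpace ℝ (Fin N)}
    (hx : x ∈ sector N m) (hy : y ∈ sector N m) : kernel m 1 x y ≤ 2 ^ m * coordProd m y := by
  rw [kernel_eq_prod m one_pos, ← prod_ite_lt_const hmN, coordProd, ← Finset.prod_mul_distrib]
  refine Finset.prod_le_prod (fun i _ => ?_) fun i _ => ?_
  · split_ifs with h
    · exact (gaussDiff_pos one_pos (hx i h) (hy i h)).le
    · exact (gauss_pos one_pos _).le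
  · split_ifs with h
    · exact gaussDiff_one_le (hx i h) (hy i h)
    · simpa using gauss_one_le (x i - y i)

lemma lintegral_ball_norm_rpow_lt_top {γ : ℝ} (hN : 1 ≤ N) (hγN : γ < N) :
    ∫⁻ y in Metric.ball (0 : EuclideanSpace ℝ (Fin N)) 1, ENNReal.ofReal (‖y‖ ^ (-γ)) < ∞ := by
  have h := integrableOn_ball_of_norm_le_rpow
    (μ := (volume : Measure (EuclideanSpace ℝ (Fin N)))) (r := 1) (C := 1) (α := γ)
    (f := fun y => ‖y‖ ^ (-γ))
    (by rwa [finrank_euclideanSpace_fin]) (by rwa [finrank_euclideanSpace_fin])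
    (ae_of_all _ fun y => by
      rw [one_mul, Real.norm_eq_abs, abs_of_nonneg (by positivity)])
    (by fun_prop : Measurable fun y : EuclideanSpace ℝ (Fin N) => ‖y‖ ^ (-γ)).aestronglyMeasurable
  exact h.lintegral_lt_top

/-- Outside the unit ball `ψ₀` is bounded. Inside it is of size `|y|^{-γ-m}`, but the kernel
contributes a factor `|y|^m` by `kernel_one_le`, and the remaining `|y|^{-γ}` is integrable because
`γ < N`. -/
lemma exists_heatPos_one_psi0_le {m : ℕ} {γ : ℝ} (hm : 1 ≤ m) (hmN : m ≤ N) (hγ : 0 < γ)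
    (hγN : γ < N) : ∃ C : ℝ, 0 < C ∧ ∀ x ∈ sector N m,
      heatPos m 1 (fun y => ENNReal.ofReal (psi0 m γ y)) x ≤ ENNReal.ofReal C := by
  set I := ∫⁻ y in Metric.ball (0 : EuclideanSpace ℝ (Fin N)) 1, ENNReal.ofReal (‖y‖ ^ (-γ))
    with hI
  have hIfin : I ≠ ∞ := (lintegral_ball_norm_rpow_lt_top (hm.trans hmN) hγN).ne
  set c := psiConst m γ
  have hc : 0 < c := psiConst_pos m hγ
  refine ⟨c + 2 ^ m * c * I.toReal, by positivity, fun x hx => ?_⟩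
  have hb := Metric.isOpen_ball (x := (0 : EuclideanSpace ℝ (Fin N))) (ε := 1) |>.measurableSet
  set g : EuclideanSpace ℝ (Fin N) → ℝ≥0∞ :=
    (Metric.ball 0 1).indicator fun y => ENNReal.ofReal (‖y‖ ^ (-γ)) with hg
  have hgm : Measurable g := Measurable.indicator (by fun_prop) hb
  have key : ∀ y ∈ sector N m, ENNReal.ofReal (kernel m 1 x y) * ENNReal.ofReal (psi0 m γ y)
      ≤ ENNReal.ofReal (kernel m 1 x y) * ENNReal.ofReal c
        + ENNReal.ofReal (2 ^ m * c) * g y := fun y hy => by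
    have hn := norm_pos_of_mem_sector hm hmN hy
    have hle := coordProd_le hmN hy
    have hcp := coordProd_pos hy
    by_cases hyb : y ∈ Metric.ball (0 : EuclideanSpace ℝ (Fin N)) 1
    · refine le_add_left ?_
      rw [hg, indicator_of_mem hyb, ← ENNReal.ofReal_mul (kernel_pos m one_pos hx hy).le,
        ← ENNReal.ofReal_mul (by positivity)]
      refine ENNReal.ofReal_le_ofReal ?_
      have hp : ‖y‖ ^ (-γ) = ‖y‖ ^ m * (‖y‖ ^ m * ‖y‖ ^ (-γ - 2 * (m : ℝ))) := by
        rw [← Real.rpow_natCast, ← Real.rpow_add hn, ← Real.rpow_add hn]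
        congr 1
        ring
      have hpos := psi0_pos hm hmN hγ hy
      calc kernel m 1 x y * psi0 m γ y
          ≤ (2 ^ m * ‖y‖ ^ m) * (c * ‖y‖ ^ m * ‖y‖ ^ (-γ - 2 * (m : ℝ))) := by
            rw [psi0_eq]
            have := kernel_one_le hmN hx hy
            have : kernel m 1 x y ≤ 2 ^ m * ‖y‖ ^ m := this.trans (by gcongr)
            gcongr
        _ = 2 ^ m * c * ‖y‖ ^ (-γ) := by rw [hp]; ring
    · refine le_add_right ?_
      gcongr
      have h1 : 1 ≤ ‖y‖ := by simpa using hyb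
      have hp : ‖y‖ ^ m * ‖y‖ ^ (-γ - 2 * (m : ℝ)) ≤ 1 := by
        rw [← Real.rpow_natCast, ← Real.rpow_add hn]
        refine Real.rpow_le_one_of_one_le_of_nonpos h1 ?_
        have : (0 : ℝ) ≤ m := by positivity
        linarith
      calc psi0 m γ y ≤ c * ‖y‖ ^ m * ‖y‖ ^ (-γ - 2 * (m : ℝ)) := by
            rw [psi0_eq]
            gcongr
        _ ≤ c := by rw [mul_assoc]; exact mul_le_of_le_one_right hc.le hp
  calc heatPos m 1 (fun y => ENNReal.ofReal (psi0 m γ y)) x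
      ≤ ∫⁻ y in sector N m, (ENNReal.ofReal (kernel m 1 x y) * ENNReal.ofReal c
        + ENNReal.ofReal (2 ^ m * c) * g y) :=
        setLIntegral_mono' (measurableSet_sector m) key
    _ = heatPos m 1 (fun _ => ENNReal.ofReal c) x
        + ENNReal.ofReal (2 ^ m * c) * ∫⁻ y in sector N m, g y := by
        rw [lintegral_add_right _ (hgm.const_mul _), lintegral_const_mul _ hgm]
        rfl
    _ ≤ ENNReal.ofReal c + ENNReal.ofReal (2 ^ m * c) * I := by
        gcongr
        · exact heatPos_const_le m one_pos _ hx
        · rw [hI, ← lintegral_indicator hb]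
          exact setLIntegral_le_lintegral _ _
    _ = ENNReal.ofReal (c + 2 ^ m * c * I.toReal) := by
        rw [ENNReal.ofReal_add hc.le (by positivity), ENNReal.ofReal_mul (p := 2 ^ m * c)
          (by positivity), ENNReal.ofReal_toReal hIfin]

lemma heatPos_of_homogeneous (m : ℕ) {t κ : ℝ} (ht : 0 < t)
    {f g : EuclideanSpace ℝ (Fin N) → ℝ≥0∞}
    (hfg : ∀ᵐ y, y ∈ sector N m → f (√t • y) = ENNReal.ofReal (t ^ κ) * g y)
    (x : EuclideanSpace ℝ (Fin N)) :
    heatPos m t f (√t • x) = ENNReal.ofReal (t ^ κ) * heatPos m 1 g x := by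
  have h := heatPos_smul m (Real.sqrt_pos.2 ht) one_pos f x
  rw [Real.sq_sqrt ht.le, mul_one] at h
  rw [h, heatPos_congr_ae m 1 hfg, heatPos_const_mul m 1 ENNReal.ofReal_ne_top]

lemma sqrt_rpow_neg {t : ℝ} (ht : 0 < t) (κ : ℝ) : √t ^ (-κ) = t ^ (-κ / 2) := by
  rw [Real.sqrt_eq_rpow, ← Real.rpow_mul ht.le]
  congr 1
  ring

lemma exists_heatPos_psi0_le {m : ℕ} {γ : ℝ} (hm : 1 ≤ m) (hmN : m ≤ N) (hγ : 0 < γ)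
    (hγN : γ < N) : ∃ C : ℝ, 0 < C ∧ ∀ t, 0 < t → ∀ x ∈ sector N m,
      heatPos m t (fun y => ENNReal.ofReal (psi0 m γ y)) x
        ≤ ENNReal.ofReal (C * t ^ (-(γ + m) / 2)) := by
  obtain ⟨C, hC, h⟩ := exists_heatPos_one_psi0_le hm hmN hγ hγN
  refine ⟨C, hC, fun t ht x hx => ?_⟩
  have hs := Real.sqrt_pos.2 ht
  have h1 := heatPos_of_homogeneous m (κ := -(γ + m) / 2) ht
    (f := fun y => ENNReal.ofReal (psi0 m γ y)) (g := fun y => ENNReal.ofReal (psi0 m γ y))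
    (ae_of_all _ fun y _ => by
      rw [psi0_smul γ hmN hs, ENNReal.ofReal_mul (by positivity), sqrt_rpow_neg ht])
    ((√t)⁻¹ • x)
  rw [smul_inv_smul₀ hs.ne'] at h1
  rw [h1, mul_comm C, ENNReal.ofReal_mul (by positivity)]
  gcongr
  exact h _ ((smul_mem_sector (inv_pos.2 hs)).2 hx)

lemma heatPos_lt_top_of_le_psi0 {m : ℕ} {γ : ℝ} (hm : 1 ≤ m) (hmN : m ≤ N) (hγ : 0 < γ)
    (hγN : γ < N) {f : EuclideanSpace ℝ (Fin N) → ℝ≥0∞} {B : ℝ≥0∞} (hB : B ≠ ∞)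
    (hf : ∀ᵐ y, y ∈ sector N m → f y ≤ B * ENNReal.ofReal (psi0 m γ y)) {t : ℝ} (ht : 0 < t)
    {x : EuclideanSpace ℝ (Fin N)} (hx : x ∈ sector N m) : heatPos m t f x < ∞ := by
  obtain ⟨C, -, h⟩ := exists_heatPos_psi0_le hm hmN hγ hγN
  refine (heatPos_mono_ae m t hf x).trans_lt ?_
  rw [heatPos_const_mul m t hB]
  exact ENNReal.mul_lt_top hB.lt_top ((h t ht x hx).trans_lt ENNReal.ofReal_lt_top)

/-! ### The norm `‖e^{Δ_m}(ω ψ₀)‖_∞` -/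

lemma ofReal_mul_psi0_le {m : ℕ} {γ : ℝ} (hm : 1 ≤ m) (hmN : m ≤ N) (hγ : 0 < γ)
    (ω : EuclideanSpace ℝ (Fin N) → ℝ) :
    ∀ᵐ y, y ∈ sector N m → ENNReal.ofReal (ω y * psi0 m γ y)
      ≤ eLpNorm ω ∞ volume * ENNReal.ofReal (psi0 m γ y) := by
  rw [eLpNorm_exponent_top]
  filter_upwards [ae_le_eLpNormEssSup (f := ω) (μ := volume)] with y hy hys
  rw [ENNReal.ofReal_mul' (psi0_pos hm hmN hγ hys).le]
  gcongr
  exact (Real.ofReal_le_enorm _).trans hy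

lemma measurePreserving_flipCoord (i : Fin N) : MeasurePreserving (flipCoord i) := by
  have h : MeasurePreserving (fun (x : Fin N → ℝ) (j : Fin N) =>
      (if j = i then fun z : ℝ => -z else id) (x j)) := by
    refine volume_preserving_pi (f := fun j => if j = i then fun z : ℝ => -z else id) fun j => ?_
    split_ifs
    · exact Measure.measurePreserving_neg volume
    · exact MeasurePreserving.id _
  have h2 := (PiLp.volume_preserving_toLp (Fin N)).comp
    (h.comp (PiLp.volume_preserving_ofLp (Fin N)))
  convert h2 using 1
  ext x j
  simp only [flipCoord, Function.comp_apply]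
  split_ifs <;> rfl

lemma ae_coord_ne_zero (i : Fin N) : ∀ᵐ x : EuclideanSpace ℝ (Fin N), x i ≠ 0 :=
  (PiLp.volume_preserving_ofLp (Fin N)).quasiMeasurePreserving.ae
    (Measure.ae_eval_ne (fun _ => (volume : Measure ℝ)) i 0)

/-- An anti-symmetric function that vanishes on the sector vanishes everywhere. -/
lemma AntiSymmetric.ae_eq_zero {m : ℕ} (hmN : m ≤ N) {f : EuclideanSpace ℝ (Fin N) → ℝ}
    (hf : AntiSymmetric m f) (h0 : ∀ᵐ x, x ∈ sector N m → f x = 0) : ∀ᵐ x, f x = 0 := by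
  -- The sign conditions are dropped one at a time: where `x_k < 0`, reflect; the hyperplane `x_k =
  -- 0` is null.
  have key : ∀ k ≤ m, ∀ᵐ x : EuclideanSpace ℝ (Fin N),
      (∀ i : Fin N, k ≤ (i : ℕ) → (i : ℕ) < m → 0 < x i) → f x = 0 := by
    intro k
    induction k with
    | zero => exact fun _ => h0.mono fun x hx h => hx fun i => h i (Nat.zero_le _)
    | succ k ih =>
      intro hk
      have ih := ih (by omega)
      let j : Fin N := ⟨k, by omega⟩
      filter_upwards [ih, (measurePreserving_flipCoord j).quasiMeasurePreserving.ae ih,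
        hf j (show k < m by omega), ae_coord_ne_zero j] with x h1 h2 h3 h4 hx
      have hext : ∀ i : Fin N, k ≤ (i : ℕ) → (i : ℕ) < m → i ≠ j → 0 < x i := fun i hki him hij =>
        hx i (lt_of_le_of_ne hki fun h => hij (Fin.ext h.symm)) him
      rcases lt_or_gt_of_ne h4 with h | h
      · rw [← neg_eq_zero, ← h3]
        refine h2 fun i hki him => ?_
        simp only [flipCoord]
        split_ifs with hij
        · rw [hij]; linarith
        · exact hext i hki him hij
      · refine h1 fun i hki him => ?_
        by_cases hij : i = j
        · rwa [hij]
        · exact hext i hki him hij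
  exact (key m le_rfl).mono fun x hx => hx fun i h1 h2 => absurd h2 (by omega)

lemma volume_sector_ne_zero (m : ℕ) : volume (sector N m) ≠ 0 := by
  have ho : IsOpen (sector N m) := by
    have : sector N m = ⋂ i : Fin N, {x | (i : ℕ) < m → 0 < x i} := by
      ext x; simp [sector]
    rw [this]
    refine isOpen_iInter_of_finite fun i => ?_
    by_cases h : (i : ℕ) < m
    · simp only [h, true_imp_iff]
      exact isOpen_lt continuous_const (by fun_prop)
    · simp [h]
  exact (ho.measure_pos volume ⟨WithLp.toLp 2 fun _ => 1, fun i _ => one_pos⟩).ne'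

/-- The point is finiteness: `toReal` would turn an infinite value of the integral into `0`. -/
lemma heatSupNorm_eq_essSup {m : ℕ} {γ : ℝ} (hm : 1 ≤ m) (hmN : m ≤ N) (hγ : 0 < γ)
    (hγN : γ < N) {ω : EuclideanSpace ℝ (Fin N) → ℝ} (hω : MemLp ω ∞)
    (hω0 : ∀ᵐ x, x ∈ sector N m → 0 ≤ ω x) :
    heatSupNorm m γ ω = essSup (heatPos m 1 fun y => ENNReal.ofReal (ω y * psi0 m γ y))
      (volume.restrict (sector N m)) := by
  rw [heatSupNorm, eLpNorm_exponent_top, eLpNormEssSup]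
  refine essSup_congr_ae ?_
  filter_upwards [ae_restrict_mem (measurableSet_sector m)] with x hx
  have h1 := heat_eq_toReal m one_pos (f := fun y => ω y * psi0 m γ y)
    (hω.1.mul (measurable_psi0 m γ).aestronglyMeasurable).restrict
    (hω0.mono fun y hy hys => mul_nonneg (hy hys) (psi0_pos hm hmN hγ hys).le) hx
  have h2 := heatPos_lt_top_of_le_psi0 hm hmN hγ hγN hω.2.ne (ofReal_mul_psi0_le hm hmN hγ ω)
    one_pos hx
  rw [h1, Real.enorm_of_nonneg ENNReal.toReal_nonneg, ENNReal.ofReal_toReal h2.ne]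

lemma heatSupNorm_lt_top {m : ℕ} {γ : ℝ} (hm : 1 ≤ m) (hmN : m ≤ N) (hγ : 0 < γ)
    (hγN : γ < N) {ω : EuclideanSpace ℝ (Fin N) → ℝ} (hω : MemLp ω ∞)
    (hω0 : ∀ᵐ x, x ∈ sector N m → 0 ≤ ω x) : heatSupNorm m γ ω < ∞ := by
  obtain ⟨C, -, h⟩ := exists_heatPos_one_psi0_le hm hmN hγ hγN
  rw [heatSupNorm_eq_essSup hm hmN hγ hγN hω hω0]
  refine (essSup_le_of_ae_le (eLpNorm ω ∞ volume * ENNReal.ofReal C) ?_).trans_lt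
    (ENNReal.mul_lt_top hω.2 ENNReal.ofReal_lt_top)
  filter_upwards [ae_restrict_mem (measurableSet_sector m)] with x hx
  refine (heatPos_mono_ae m 1 (ofReal_mul_psi0_le hm hmN hγ ω) x).trans ?_
  rw [heatPos_const_mul m 1 hω.2.ne]
  gcongr
  exact h x hx

/-- The kernel is strictly positive, so if `e^{Δ_m}(ω ψ₀)` vanishes at a single point of the sector,
then `ω = 0` on the sector, and by anti-symmetry everywhere. -/
lemma heatSupNorm_pos {m : ℕ} {γ : ℝ} (hm : 1 ≤ m) (hmN : m ≤ N) (hγ : 0 < γ)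
    (hγN : γ < N) {ω : EuclideanSpace ℝ (Fin N) → ℝ} (hω : MemLp ω ∞)
    (hω0 : ∀ᵐ x, x ∈ sector N m → 0 ≤ ω x) (hanti : AntiSymmetric m ω)
    (hne : ¬ ∀ᵐ x, ω x = 0) : 0 < heatSupNorm m γ ω := by
  rw [pos_iff_ne_zero, heatSupNorm_eq_essSup hm hmN hγ hγN hω hω0, Ne, ENNReal.essSup_eq_zero_iff]
  intro h
  have hS := measurableSet_sector (N := N) m
  have hne0 : (ae (volume.restrict (sector N m))).NeBot := by
    rw [ae_neBot, Ne, Measure.restrict_eq_zero]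
    exact volume_sector_ne_zero m
  obtain ⟨x, hx0, hx⟩ := (h.and (ae_restrict_mem hS)).exists
  have hmeas : AEMeasurable (fun y => ENNReal.ofReal (kernel m 1 x y)
      * ENNReal.ofReal (ω y * psi0 m γ y)) (volume.restrict (sector N m)) :=
    (measurable_kernel_right m 1 x).ennreal_ofReal.aemeasurable.mul
      (hω.1.aemeasurable.mul (measurable_psi0 m γ).aemeasurable).restrict.ennreal_ofReal
  have h0 := (ae_restrict_iff' hS).1 ((lintegral_eq_zero_iff' hmeas).1 hx0)
  refine hne (hanti.ae_eq_zero hmN ?_)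
  filter_upwards [h0, hω0] with y hy hy0 hys
  have h1 := hy hys
  simp only [Pi.zero_apply, mul_eq_zero, ENNReal.ofReal_eq_zero] at h1
  rcases h1 with h1 | h1
  · exact absurd (kernel_pos m one_pos hx hys) h1.not_gt
  · have hp := psi0_pos hm hmN hγ hys
    exact le_antisymm (nonpos_of_mul_nonpos_left h1 hp) (hy0 hys)

/-! ### Blow-up of nonnegative solutions -/

/-- A finite solution on `(0, t)` of the integral inequality `H(s) ≥ A + ∫₀ˢ H^{α+1}` forces
`t ≤ 1 / (α A^α)`. -/
lemma mul_rpow_le_one_of_integral_inequality {α t A : ℝ} (hα : 0 < α) (ht : 0 < t) (hA : 0 < A)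
    {k : ℝ → ℝ≥0∞} (hk : Measurable k) (hfin : ∫⁻ s in Ioo 0 t, k s ≠ ∞)
    (h : ∀ᵐ s, s ∈ Ioo 0 t → (ENNReal.ofReal A + ∫⁻ σ in Ioo 0 s, k σ) ^ (α + 1) ≤ k s) :
    α * t * A ^ α ≤ 1 := by
  set kr : ℝ → ℝ := (Ioo 0 t).indicator fun s => (k s).toReal with hkr
  have hkint : Integrable kr := by
    rw [hkr, integrable_indicator_iff measurableSet_Ioo]
    exact integrable_toReal_of_lintegral_ne_top hk.aemeasurable hfin
  have hkr0 : ∀ s, 0 ≤ kr s := indicator_nonneg fun s _ => ENNReal.toReal_nonneg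
  have hlt : ∀ᵐ s, s ∈ Ioo 0 t → k s < ∞ :=
    (ae_restrict_iff' measurableSet_Ioo).1 (ae_lt_top hk hfin)
  set G : ℝ → ℝ := fun s => A + ∫ σ in (0 : ℝ)..s, kr σ with hG
  have hGc : Continuous G := continuous_const.add
    (intervalIntegral.continuous_primitive (fun _ _ => hkint.intervalIntegrable) 0)
  have hGeq : ∀ s ∈ Ioo 0 t, ENNReal.ofReal A + ∫⁻ σ in Ioo 0 s, k σ = ENNReal.ofReal (G s) := by
    intro s hs
    have hsub : Ioo 0 s ⊆ Ioo 0 t := Ioo_subset_Ioo_right hs.2.le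
    rw [hG, ENNReal.ofReal_add hA.le (intervalIntegral.integral_nonneg hs.1.le fun σ _ => hkr0 σ),
      intervalIntegral.integral_of_le hs.1.le, integral_Ioc_eq_integral_Ioo,
      ofReal_integral_eq_lintegral_ofReal hkint.integrableOn (ae_of_all _ hkr0)]
    congr 1
    refine setLIntegral_congr_fun_ae measurableSet_Ioo ?_
    filter_upwards [hlt] with σ hσ hσs
    rw [hkr, indicator_of_mem (hsub hσs), ENNReal.ofReal_toReal (hσ (hsub hσs)).ne]
  have hGA : ∀ s, 0 ≤ s → A ≤ G s := fun s hs =>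
    le_add_of_nonneg_right (intervalIntegral.integral_nonneg hs fun σ _ => hkr0 σ)
  set f : ℝ → ℝ := fun s => |G s| ^ (α + 1) with hf
  have hfc : Continuous f := hGc.abs.rpow_const fun _ => Or.inr (by linarith)
  have hf0 : ∀ s, 0 ≤ f s := fun s => by positivity
  have hfk : ∀ᵐ s, s ∈ Ioo 0 t → f s ≤ kr s := by
    filter_upwards [h, hlt] with s hs hs' hst
    have h1 := hs hst
    have hGs := hA.le.trans (hGA s hst.1.le)
    rw [hGeq s hst, ENNReal.ofReal_rpow_of_nonneg hGs (by linarith),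
      ENNReal.ofReal_le_iff_le_toReal (hs' hst).ne] at h1
    simp only [hkr, indicator_of_mem hst, hf, abs_of_nonneg hGs]
    exact h1
  -- `k` is merely integrable, so `G` need not be differentiable everywhere. `Y` is a `C¹` minorant
  -- of `G` with `Y' = |G|^{α+1} ≥ Y^{α+1}` on `(0, t)`.
  set Y : ℝ → ℝ := fun s => A + ∫ σ in (0 : ℝ)..s, f σ with hY
  have hYd : ∀ s, HasDerivAt Y (f s) s := fun s =>
    (hfc.integral_hasStrictDerivAt 0 s).hasDerivAt.const_add A
  have hYA : ∀ s, 0 ≤ s → A ≤ Y s := fun s hs =>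
    le_add_of_nonneg_right (intervalIntegral.integral_nonneg hs fun σ _ => hf0 σ)
  have hYG : ∀ s ∈ Ioo 0 t, Y s ≤ G s := by
    intro s hs
    refine add_le_add_right ?_ A
    rw [intervalIntegral.integral_of_le hs.1.le, intervalIntegral.integral_of_le hs.1.le,
      integral_Ioc_eq_integral_Ioo, integral_Ioc_eq_integral_Ioo]
    refine setIntegral_mono_on_ae
      ((hfc.integrableOn_Icc (a := 0) (b := s)).mono_set Ioo_subset_Icc_self)
      hkint.integrableOn measurableSet_Ioo ?_
    filter_upwards [hfk] with σ hσ hσs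
    exact hσ ⟨hσs.1, hσs.2.trans hs.2⟩
  -- `Y' ≥ Y^{α+1}` means `(Y^{-α})' ≤ -α`, so `Z` is nonincreasing; comparing its values at `0` and
  -- `t` gives `α t ≤ A^{-α}`.
  set Z : ℝ → ℝ := fun s => Y s ^ (-α) + α * s with hZ
  have hZd : ∀ s, 0 ≤ s → HasDerivAt Z (f s * (-α) * Y s ^ (-α - 1) + α) s := fun s hs => by
    have h1 := (hYd s).rpow_const (p := -α) (Or.inl (hA.trans_le (hYA s hs)).ne')
    simpa using! h1.add ((hasDerivAt_id s).const_mul α)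
  have hanti : AntitoneOn Z (Icc 0 t) := by
    refine antitoneOn_of_deriv_nonpos (convex_Icc 0 t)
      (fun s hs => (hZd s hs.1).continuousAt.continuousWithinAt)
      (fun s hs => ?_) fun s hs => ?_
    · rw [interior_Icc] at hs
      exact (hZd s hs.1.le).differentiableAt.differentiableWithinAt
    · rw [interior_Icc] at hs
      rw [(hZd s hs.1.le).deriv]
      have hYs := hA.trans_le (hYA s hs.1.le)
      have h1 : 1 ≤ f s * Y s ^ (-α - 1) := by
        have h2 : Y s ^ (α + 1) ≤ f s := by
          rw [hf]
          exact Real.rpow_le_rpow hYs.le ((hYG s hs).trans (le_abs_self _)) (by linarith)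
        calc (1 : ℝ) = Y s ^ (α + 1) * Y s ^ (-α - 1) := by
              rw [← Real.rpow_add hYs]; norm_num
          _ ≤ f s * Y s ^ (-α - 1) := by gcongr
      nlinarith
  have hfinal := hanti (left_mem_Icc.2 ht.le) (right_mem_Icc.2 ht.le) ht.le
  have hY0 : Y 0 = A := by simp [hY]
  have hYt : 0 ≤ Y t ^ (-α) := Real.rpow_nonneg (hA.le.trans (hYA t ht.le)) _
  simp only [hZ, hY0, mul_zero, add_zero] at hfinal
  calc α * t * A ^ α ≤ A ^ (-α) * A ^ α := by gcongr; linarith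
    _ = 1 := by rw [← Real.rpow_add hA]; simp

lemma IsNonnegSolution.mul_heatPos_rpow_le_one {m : ℕ} {α T : ℝ} (hα : 0 < α)
    {φ : EuclideanSpace ℝ (Fin N) → ℝ} {u : ℝ → EuclideanSpace ℝ (Fin N) → ℝ≥0}
    (hφ : AEStronglyMeasurable φ (volume.restrict (sector N m)))
    (hu : IsNonnegSolution m α φ T u) :
    ∀ᵐ t, t ∈ Ioo 0 T → ∀ᵐ x, x ∈ sector N m →
      ENNReal.ofReal (α * t) * heatPos m t (fun y => ENNReal.ofReal (φ y)) x ^ α ≤ 1 := by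
  have hum : Measurable fun p : ℝ × EuclideanSpace ℝ (Fin N) => (u p.1 p.2 : ℝ≥0∞) :=
    hu.measurable.coe_nnreal_ennreal
  have hup := hum.pow_const (α + 1)
  have heq := Measure.ae_ae_of_ae_prod (hu.integral_eq)
  filter_upwards [heq] with t ht htT
  filter_upwards [ht] with x hx hxS
  have hx := hx htT hxS
  set Φ : EuclideanSpace ℝ (Fin N) → ℝ≥0∞ := fun y => ENNReal.ofReal (φ y) with hΦ
  set k : ℝ → ℝ≥0∞ := fun σ => heatPos m (t - σ) (fun y => (u σ y : ℝ≥0∞) ^ (α + 1)) x with hk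
  have hkm : Measurable k := measurable_heatPos m (by fun_prop) (by fun_prop) hup
  -- Blow-up enters here: the solution has a finite value at `(t, x)`, so both terms of the equation
  -- are finite.
  have hne : heatPos m t Φ x + ∫⁻ s in Ioo 0 t, k s ≠ ∞ := by
    rw [← hx]
    exact ENNReal.coe_ne_top
  have hA := (ENNReal.add_ne_top.1 hne).1
  rcases eq_or_ne (heatPos m t Φ x) 0 with h0 | h0
  · rw [h0, ENNReal.zero_rpow_of_pos hα, mul_zero]
    exact zero_le_one
  have hAr := ENNReal.toReal_pos h0 hA
  have key := mul_rpow_le_one_of_integral_inequality hα htT.1 hAr hkm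
    (ENNReal.add_ne_top.1 hne).2 ?_
  · rw [← ENNReal.ofReal_toReal hA, ENNReal.ofReal_rpow_of_pos hAr,
      ← ENNReal.ofReal_mul (mul_nonneg hα.le htT.1.le)]
    exact ENNReal.ofReal_le_one.2 key
  · filter_upwards [heq] with s hs hst
    have hts : 0 < t - s := sub_pos.2 hst.2
    have husm : Measurable fun y => (u s y : ℝ≥0∞) :=
      hum.comp (by fun_prop : Measurable fun y => (s, y))
    have hFm : Measurable (Function.uncurry fun σ y =>
        heatPos m (s - σ) (fun z => (u σ z : ℝ≥0∞) ^ (α + 1)) y) := by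
      refine measurable_heatPos m (by fun_prop) measurable_snd ?_
      exact hup.comp (by fun_prop : Measurable
        fun q : (ℝ × EuclideanSpace ℝ (Fin N)) × EuclideanSpace ℝ (Fin N) => (q.1.1, q.2))
    have hIm : Measurable fun y =>
        ∫⁻ σ in Ioo 0 s, heatPos m (s - σ) (fun z => (u σ z : ℝ≥0∞) ^ (α + 1)) y :=
      hFm.lintegral_prod_left'
    -- The equation at time `s`, transported to time `t` by the semigroup law; the right-hand side
    -- is `H(s)`.
    have h1 : heatPos m (t - s) (fun y => (u s y : ℝ≥0∞)) x
        = heatPos m t Φ x + ∫⁻ σ in Ioo 0 s, k σ := by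
      rw [heatPos_congr_ae m (t - s) (hs.mono fun y hy hyS => hy ⟨hst.1, hst.2.trans htT.2⟩ hyS),
        heatPos_add_right m (t - s) _ hIm,
        heatPos_lintegral m (t - s) _ hFm,
        heatPos_heatPos m hts hst.1 hφ.aemeasurable.ennreal_ofReal hxS, sub_add_cancel]
      congr 1
      refine setLIntegral_congr_fun measurableSet_Ioo fun σ hσ => ?_
      have husm : Measurable fun y => (u σ y : ℝ≥0∞) ^ (α + 1) :=
        hup.comp (by fun_prop : Measurable fun y => (σ, y))
      simp only [hk]
      rw [heatPos_heatPos m hts (sub_pos.2 hσ.2) husm.aemeasurable hxS, sub_add_sub_cancel]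
    rw [ENNReal.ofReal_toReal hA, ← h1]
    exact heatPos_rpow_le m hts hα husm hxS

/-! ### Regular solutions are nonnegative solutions -/

/-- `e^{tΔ_m} ψ₀` with values in `[0, ∞]`. -/
def psiHeat (m : ℕ) (γ t : ℝ) (x : EuclideanSpace ℝ (Fin N)) : ℝ≥0∞ :=
  heatPos m t (fun y => ENNReal.ofReal (psi0 m γ y)) x

lemma heatPos_psiHeat (m : ℕ) (γ : ℝ) {s t : ℝ} (hs : 0 < s) (hst : s < t)
    {x : EuclideanSpace ℝ (Fin N)} (hx : x ∈ sector N m) :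
    heatPos m (t - s) (psiHeat m γ s) x = psiHeat m γ t x := by
  have h := heatPos_heatPos m (sub_pos.2 hst) hs
    (measurable_psi0 (N := N) m γ).ennreal_ofReal.aemeasurable hx
  rwa [sub_add_cancel] at h

lemma ofReal_abs_rpow_mul {α : ℝ} (hα : 0 < α) (a : ℝ) :
    ENNReal.ofReal (|a| ^ α * a) = ENNReal.ofReal a ^ (α + 1) := by
  rcases le_or_gt a 0 with h | h
  · rw [ENNReal.ofReal_of_nonpos h, ENNReal.zero_rpow_of_pos (by linarith),
      ENNReal.ofReal_of_nonpos (mul_nonpos_of_nonneg_of_nonpos (by positivity) h)]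
  · rw [abs_of_pos h, ENNReal.ofReal_rpow_of_pos h, Real.rpow_add_one h.ne']

/-- The two bounds on `w` play different roles: the a priori one controls `w^α` through the decay of
`e^{sΔ_m} ψ₀`, and the one with `c`, which an iteration improves, controls the remaining factor `w`.
-/
lemma heatPos_rpow_succ_le {m : ℕ} {α γ C M c s t : ℝ} (hα : 0 < α) (hC0 : 0 ≤ C)
    (hC : ∀ t, 0 < t → ∀ x ∈ sector N m,
      psiHeat m γ t x ≤ ENNReal.ofReal (C * t ^ (-(γ + m) / 2))) (hM : 0 ≤ M)
    (hs : 0 < s) (hst : s < t) {w : EuclideanSpace ℝ (Fin N) → ℝ≥0∞}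
    (h1 : ∀ y ∈ sector N m, w y ≤ ENNReal.ofReal M * psiHeat m γ s y)
    (h2 : ∀ y ∈ sector N m, w y ≤ ENNReal.ofReal c * psiHeat m γ s y)
    {x : EuclideanSpace ℝ (Fin N)} (hx : x ∈ sector N m) :
    heatPos m (t - s) (fun y => w y ^ (α + 1)) x
      ≤ ENNReal.ofReal ((M * C) ^ α * s ^ (-(α * (γ + m) / 2)) * c) * psiHeat m γ t x := by
  have key : ∀ y ∈ sector N m, w y ^ (α + 1)
      ≤ ENNReal.ofReal ((M * C) ^ α * s ^ (-(α * (γ + m) / 2)) * c) * psiHeat m γ s y := by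
    intro y hy
    have h3 : w y ^ α ≤ ENNReal.ofReal ((M * C) ^ α * s ^ (-(α * (γ + m) / 2))) := by
      have h4 : w y ≤ ENNReal.ofReal (M * C * s ^ (-(γ + m) / 2)) := by
        refine (h1 y hy).trans ?_
        rw [mul_assoc, ENNReal.ofReal_mul hM]
        gcongr
        exact hC s hs y hy
      calc w y ^ α ≤ ENNReal.ofReal (M * C * s ^ (-(γ + m) / 2)) ^ α := by gcongr
        _ = _ := by
          rw [ENNReal.ofReal_rpow_of_nonneg (by positivity) hα.le,
            Real.mul_rpow (by positivity) (by positivity), ← Real.rpow_mul hs.le]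
          congr 3
          ring
    rw [ENNReal.rpow_add_of_nonneg _ _ hα.le zero_le_one, ENNReal.rpow_one,
      ENNReal.ofReal_mul (by positivity), mul_assoc]
    exact mul_le_mul' h3 (h2 y hy)
  refine (heatPos_mono_ae m _ (ae_of_all _ key) x).trans (le_of_eq ?_)
  rw [heatPos_const_mul m _ ENNReal.ofReal_ne_top, heatPos_psiHeat m γ hs hst hx]

lemma lintegral_ofReal_mul_rpow {c q t : ℝ} (hc : 0 ≤ c) (hq : 0 < q) (ht : 0 < t) :
    ∫⁻ s in Ioo 0 t, ENNReal.ofReal (c * s ^ (q - 1)) = ENNReal.ofReal (c * (t ^ q / q)) := by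
  have hint : IntervalIntegrable (fun s : ℝ => c * s ^ (q - 1)) volume 0 t :=
    (intervalIntegral.intervalIntegrable_rpow' (by linarith)).const_mul c
  rw [intervalIntegrable_iff_integrableOn_Ioo_of_le ht.le] at hint
  rw [← ofReal_integral_eq_lintegral_ofReal hint, ← integral_Ioc_eq_integral_Ioo,
    ← intervalIntegral.integral_of_le ht.le, intervalIntegral.integral_const_mul,
    integral_rpow (Or.inl (by linarith))]
  · rw [sub_add_cancel, Real.zero_rpow hq.ne', sub_zero]
  · filter_upwards [ae_restrict_mem measurableSet_Ioo] with s hs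
    have := hs.1
    simp only [Pi.zero_apply]
    positivity

section regular

variable {m : ℕ} {α γ T : ℝ} {φ : EuclideanSpace ℝ (Fin N) → ℝ}
  {u : ℝ → C₀(EuclideanSpace ℝ (Fin N), ℝ)}

lemma IsRegularSolution.exists_abs_le (hm : 1 ≤ m) (hmN : m ≤ N) (hγ : 0 < γ)
    (hu : IsRegularSolution m α γ φ T u) {t : ℝ} (ht : t < T) :
    ∃ M : ℝ, 0 ≤ M ∧ ∀ s ∈ Ioc 0 t, ∀ x ∈ sector N m,
      ENNReal.ofReal |u s x| ≤ ENNReal.ofReal M * psiHeat m γ s x := by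
  obtain ⟨M, hM⟩ := hu.bound t ht
  refine ⟨max M 0, le_max_right _ _, fun s hs x hx => ?_⟩
  have h0 : 0 ≤ heat m s (psi0 m γ) x := by
    rw [heat_eq_toReal m hs.1 (measurable_psi0 m γ).aestronglyMeasurable
      (ae_of_all _ fun y hy => (psi0_pos hm hmN hγ hy).le) hx]
    exact ENNReal.toReal_nonneg
  calc ENNReal.ofReal |u s x| ≤ ENNReal.ofReal (max M 0 * heat m s (psi0 m γ) x) := by
        refine ENNReal.ofReal_le_ofReal ((hM s hs x hx).trans ?_)
        gcongr
        exact le_max_left _ _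
    _ ≤ ENNReal.ofReal (max M 0) * psiHeat m γ s x := by
        rw [ENNReal.ofReal_mul (le_max_right _ _)]
        gcongr
        exact ofReal_heat_le m hs.1 _ hx

lemma IsRegularSolution.ofReal_neg_le (hα : 0 < α)
    (hφ0 : ∀ᵐ y, y ∈ sector N m → 0 ≤ φ y)
    (hu : IsRegularSolution m α γ φ T u) {t : ℝ} (ht : t ∈ Ioo 0 T)
    {x : EuclideanSpace ℝ (Fin N)} (hx : x ∈ sector N m) :
    ENNReal.ofReal (-u t x) ≤ ∫⁻ s in Ioo 0 t,
      heatPos m (t - s) (fun y => ENNReal.ofReal (-u s y) ^ (α + 1)) x := by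
  have h0 : 0 ≤ heat m t φ x := by
    refine integral_nonneg_of_ae ?_
    filter_upwards [(ae_restrict_iff' (measurableSet_sector m)).2 hφ0,
      ae_restrict_mem (measurableSet_sector m)] with y hy hys
    exact mul_nonneg (kernel_pos m ht.1 hx hys).le hy
  have h1 : -u t x ≤ ∫ s in Ioo 0 t, -heat m (t - s) (fun y => |u s y| ^ α * u s y) x := by
    rw [integral_neg, ← integral_Ioc_eq_integral_Ioo, ← intervalIntegral.integral_of_le ht.1.le,
      hu.integral_eq t ht x hx]
    linarith
  refine (ENNReal.ofReal_le_ofReal h1).trans ((ofReal_integral_le _ _).trans ?_)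
  refine setLIntegral_mono' measurableSet_Ioo fun s hs => ?_
  have h2 : -heat m (t - s) (fun y => |u s y| ^ α * u s y) x
      = heat m (t - s) (fun y => |(-u s y)| ^ α * (-u s y)) x := by
    unfold heat
    rw [← integral_neg]
    refine integral_congr_ae (ae_of_all _ fun y => ?_)
    simp only [abs_neg]
    ring
  rw [h2]
  refine (ofReal_heat_le m (sub_pos.2 hs.2) _ hx).trans (le_of_eq ?_)
  simp_rw [ofReal_abs_rpow_mul hα]

/-- Iterating the inequality for the negative part, starting from the a priori bound, gains a factor
`s^δ / n` up to constants at each step, so the bounds tend to `0`. -/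
lemma IsRegularSolution.nonneg (hm : 1 ≤ m) (hmN : m ≤ N) (hγ : 0 < γ) (hγN : γ < N)
    (hα : 0 < α) (hα' : α < 2 / (γ + m)) (hφ0 : ∀ᵐ y, y ∈ sector N m → 0 ≤ φ y)
    (hu : IsRegularSolution m α γ φ T u) {t : ℝ} (ht : t ∈ Ioo 0 T)
    {x : EuclideanSpace ℝ (Fin N)} (hx : x ∈ sector N m) : 0 ≤ u t x := by
  obtain ⟨C, hC0, hC⟩ := exists_heatPos_psi0_le hm hmN hγ hγN
  obtain ⟨M, hM0, hM⟩ := hu.exists_abs_le hm hmN hγ ht.2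
  have hM' : ∀ s ∈ Ioc 0 t, ∀ y ∈ sector N m,
      ENNReal.ofReal (-u s y) ≤ ENNReal.ofReal M * psiHeat m γ s y := fun s hs y hy =>
    (ENNReal.ofReal_le_ofReal (neg_le_abs _)).trans (hM s hs y hy)
  have hγm : 0 < γ + m := by positivity
  -- The weight is `s^{δ-1}`, integrable at `0` exactly when `α < 2/(γ+m)`.
  set δ := 1 - α * (γ + m) / 2 with hδ
  have hδ0 : 0 < δ := by
    rw [lt_div_iff₀ hγm] at hα'
    linarith
  set K := (M * C) ^ α with hK
  have hK0 : 0 ≤ K := by positivity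
  have key : ∀ n : ℕ, ∀ s ∈ Ioc 0 t, ∀ y ∈ sector N m, ENNReal.ofReal (-u s y)
      ≤ ENNReal.ofReal (M * (K / δ) ^ n * s ^ (n * δ) / n.factorial) * psiHeat m γ s y := by
    intro n
    induction n with
    | zero => simpa using hM'
    | succ n ih =>
      intro s hs y hy
      have hsT : s ∈ Ioo 0 T := ⟨hs.1, hs.2.trans_lt ht.2⟩
      have hfin : psiHeat m γ s y ≠ ∞ := ((hC s hs.1 y hy).trans_lt ENNReal.ofReal_lt_top).ne
      calc ENNReal.ofReal (-u s y)
          ≤ ∫⁻ σ in Ioo 0 s, heatPos m (s - σ) (fun z => ENNReal.ofReal (-u σ z) ^ (α + 1)) y :=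
            hu.ofReal_neg_le hα hφ0 hsT hy
        _ ≤ ∫⁻ σ in Ioo 0 s, ENNReal.ofReal (K * (M * (K / δ) ^ n) / n.factorial
              * σ ^ ((n + 1 : ℕ) * δ - 1)) * psiHeat m γ s y := by
            refine setLIntegral_mono' measurableSet_Ioo fun σ hσ => ?_
            have hσt : σ ∈ Ioc 0 t := ⟨hσ.1, hσ.2.le.trans hs.2⟩
            refine (heatPos_rpow_succ_le hα hC0.le hC hM0 hσ.1 hσ.2 (hM' σ hσt) (ih σ hσt)
              hy).trans (le_of_eq ?_)
            have he : σ ^ ((n + 1 : ℕ) * δ - 1) = σ ^ (-(α * (γ + m) / 2)) * σ ^ (n * δ) := by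
              rw [← Real.rpow_add hσ.1]
              congr 1
              rw [hδ]
              push_cast
              ring
            rw [he]
            congr 2
            ring
        _ = ENNReal.ofReal (M * (K / δ) ^ (n + 1) * s ^ ((n + 1 : ℕ) * δ) / (n + 1).factorial)
              * psiHeat m γ s y := by
            rw [lintegral_mul_const' _ _ hfin, lintegral_ofReal_mul_rpow (by positivity)
              (by positivity) hs.1]
            congr 2
            rw [Nat.factorial_succ, pow_succ]
            push_cast
            field_simp
  have hlim : Tendsto (fun n : ℕ => ENNReal.ofReal
      (M * (K / δ) ^ n * t ^ (n * δ) / n.factorial) * psiHeat m γ t x) atTop (nhds 0) := by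
    have h1 : Tendsto (fun n : ℕ => M * (((K / δ) * t ^ δ) ^ n / n.factorial)) atTop
        (nhds (M * 0)) := (FloorSemiring.tendsto_pow_div_factorial_atTop _).const_mul M
    have h2 := ENNReal.Tendsto.mul_const (ENNReal.tendsto_ofReal h1)
      (Or.inr ((hC t ht.1 x hx).trans_lt ENNReal.ofReal_lt_top).ne)
    rw [mul_zero, ENNReal.ofReal_zero, zero_mul] at h2
    refine h2.congr fun n => ?_
    congr 2
    rw [mul_pow, ← Real.rpow_mul_natCast ht.1.le, mul_comm δ]
    ring
  have h := ge_of_tendsto' hlim fun n => key n t ⟨ht.1, le_rfl⟩ x hx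
  have := ENNReal.ofReal_eq_zero.1 (le_antisymm h (zero_le))
  linarith

/-- Continuity in time for the sup norm gives joint continuity on `(0, T) × ℝ^N`. Outside `(0, T)`
nothing is known about `u`, hence the indicator. -/
lemma IsRegularSolution.measurable_toNNReal (hu : IsRegularSolution m α γ φ T u) :
    Measurable fun p : ℝ × EuclideanSpace ℝ (Fin N) =>
      (Ioo 0 T).indicator (fun t => (u t p.2).toNNReal) p.1 := by
  have hmeas : MeasurableSet (Ioo 0 T ×ˢ (univ : Set (EuclideanSpace ℝ (Fin N)))) :=
    measurableSet_Ioo.prod MeasurableSet.univ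
  have hcont : ContinuousOn (fun p : ℝ × EuclideanSpace ℝ (Fin N) => u p.1 p.2)
      (Ioo 0 T ×ˢ univ) := by
    have h1 : ContinuousOn (fun p : ℝ × EuclideanSpace ℝ (Fin N) => (u p.1).toBCF)
        (Ioo 0 T ×ˢ univ) :=
      (ZeroAtInftyContinuousMap.isometry_toBCF).continuous.comp_continuousOn
        (hu.continuousOn.comp continuousOn_fst fun p hp => hp.1)
    exact h1.eval continuousOn_snd
  classical
  have := ContinuousOn.measurable_piecewise (g := fun _ => (0 : ℝ≥0))
    (continuous_real_toNNReal.comp_continuousOn hcont) continuousOn_const hmeas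
  convert this using 1
  ext1 p
  by_cases hp : p.1 ∈ Ioo 0 T
  · rw [indicator_of_mem hp, piecewise_eq_of_mem _ _ _ (mk_mem_prod hp (mem_univ _))]
    rfl
  · rw [indicator_of_notMem hp, piecewise_eq_of_notMem _ _ _ fun h => hp h.1]

/-- By nonnegativity the two equations differ only in the kind of integral. Passing to `[0, ∞]`
requires both terms on the right to be finite, which the bound by `e^{tΔ_m} ψ₀` and `φ ∈ 𝒳` provide.
-/
lemma IsRegularSolution.isNonnegSolution (hm : 1 ≤ m) (hmN : m ≤ N) (hγ : 0 < γ) (hγN : γ < N)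
    (hα : 0 < α) (hα' : α < 2 / (γ + m)) (hφX : MemX m γ φ)
    (hφ0 : ∀ᵐ y, y ∈ sector N m → 0 ≤ φ y) (hu : IsRegularSolution m α γ φ T u) :
    IsNonnegSolution m α φ T fun t x => (Ioo 0 T).indicator (fun t => (u t x).toNNReal) t := by
  have hS := measurableSet_sector (N := N) m
  have hmeas := hu.measurable_toNNReal
  refine ⟨hmeas, ae_of_all _ fun p ht hx => ?_⟩
  obtain ⟨t, x⟩ := p
  obtain ⟨C, hC0, hC⟩ := exists_heatPos_psi0_le hm hmN hγ hγN
  obtain ⟨M, hM0, hM⟩ := hu.exists_abs_le hm hmN hγ ht.2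
  have hM' : ∀ s ∈ Ioc 0 t, ∀ y ∈ sector N m,
      ENNReal.ofReal (u s y) ≤ ENNReal.ofReal M * psiHeat m γ s y := fun s hs y hy =>
    (ENNReal.ofReal_le_ofReal (le_abs_self _)).trans (hM s hs y hy)
  simp only at ht hx ⊢
  set k : ℝ → ℝ≥0∞ := fun s => heatPos m (t - s)
    (fun y => (((Ioo 0 T).indicator (fun t => (u t y).toNNReal) s : ℝ≥0) : ℝ≥0∞) ^ (α + 1)) x
    with hk
  have hkm : Measurable k := measurable_heatPos m (by fun_prop) (by fun_prop)
    (hmeas.coe_nnreal_ennreal.pow_const _)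
  have hkeq : ∀ s ∈ Ioo 0 t,
      k s = heatPos m (t - s) (fun y => ENNReal.ofReal (u s y) ^ (α + 1)) x := fun s hs => by
    have hsT : s ∈ Ioo 0 T := ⟨hs.1, hs.2.trans ht.2⟩
    simp only [hk, indicator_of_mem hsT]
    rfl
  have hkheat : ∀ s ∈ Ioo 0 t,
      heat m (t - s) (fun y => |u s y| ^ α * u s y) x = (k s).toReal := fun s hs => by
    have hcont : Continuous fun y => |u s y| ^ α * u s y :=
      ((map_continuous (u s)).abs.rpow_const fun _ => Or.inr hα.le).mul (map_continuous (u s))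
    rw [hkeq s hs, heat_eq_toReal m (sub_pos.2 hs.2) hcont.aestronglyMeasurable _ hx]
    · simp_rw [ofReal_abs_rpow_mul hα]
    · refine ae_of_all _ fun y hy => mul_nonneg (by positivity) ?_
      exact hu.nonneg hm hmN hγ hγN hα hα' hφ0 ⟨hs.1, hs.2.trans ht.2⟩ hy
  have hfin : ∫⁻ s in Ioo 0 t, k s < ∞ := by
    have hγm : 0 < γ + m := by positivity
    have hδ0 : 0 < 1 - α * (γ + m) / 2 := by
      rw [lt_div_iff₀ hγm] at hα'
      linarith
    have hfin : psiHeat m γ t x ≠ ∞ := ((hC t ht.1 x hx).trans_lt ENNReal.ofReal_lt_top).ne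
    calc ∫⁻ s in Ioo 0 t, k s ≤ ∫⁻ s in Ioo 0 t, ENNReal.ofReal (((M * C) ^ α * M)
          * s ^ ((1 - α * (γ + m) / 2) - 1)) * psiHeat m γ t x := by
          refine setLIntegral_mono' measurableSet_Ioo fun s hs => ?_
          have hst : s ∈ Ioc 0 t := ⟨hs.1, hs.2.le⟩
          rw [hkeq s hs]
          refine (heatPos_rpow_succ_le hα hC0.le hC hM0 hs.1 hs.2 (hM' s hst) (hM' s hst)
            hx).trans (le_of_eq ?_)
          rw [show (1 - α * (γ + m) / 2) - 1 = -(α * (γ + m) / 2) by ring, mul_right_comm]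
      _ < ∞ := by
          rw [lintegral_mul_const' _ _ hfin, lintegral_ofReal_mul_rpow (by positivity) hδ0 ht.1]
          exact ENNReal.mul_lt_top ENNReal.ofReal_lt_top hfin.lt_top
  have hφfin : heatPos m t (fun y => ENNReal.ofReal (φ y)) x < ∞ := by
    refine heatPos_lt_top_of_le_psi0 hm hmN hγ hγN hφX.2.2.ne ?_ ht.1 hx
    rw [eLpNorm_exponent_top]
    filter_upwards [(ae_restrict_iff' hS).1 (ae_le_eLpNormEssSup
      (f := fun y => φ y / psi0 m γ y) (μ := volume.restrict (sector N m)))] with y hy hys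
    have hp := psi0_pos hm hmN hγ hys
    calc ENNReal.ofReal (φ y)
        = ENNReal.ofReal (φ y / psi0 m γ y) * ENNReal.ofReal (psi0 m γ y) := by
          rw [← ENNReal.ofReal_mul' hp.le, div_mul_cancel₀ _ hp.ne']
      _ ≤ _ := by
          gcongr
          exact (Real.ofReal_le_enorm _).trans (hy hys)
  rw [indicator_of_mem ht]
  change ENNReal.ofReal (u t x) = _
  rw [hu.integral_eq t ht x hx, heat_eq_toReal m ht.1 hφX.1.aestronglyMeasurable hφ0 hx,
    intervalIntegral.integral_of_le ht.1.le, integral_Ioc_eq_integral_Ioo,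
    setIntegral_congr_fun measurableSet_Ioo hkheat,
    integral_toReal hkm.aemeasurable (ae_lt_top hkm hfin.ne),
    ENNReal.ofReal_add ENNReal.toReal_nonneg ENNReal.toReal_nonneg,
    ENNReal.ofReal_toReal hφfin.ne, ENNReal.ofReal_toReal hfin.ne]

end regular

lemma Tmax_le_TmaxNonneg {m : ℕ} {α γ : ℝ} (hm : 1 ≤ m) (hmN : m ≤ N) (hγ : 0 < γ) (hγN : γ < N)
    (hα : 0 < α) (hα' : α < 2 / (γ + m)) {φ : EuclideanSpace ℝ (Fin N) → ℝ} (hφX : MemX m γ φ)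
    (hφ0 : ∀ᵐ y, y ∈ sector N m → 0 ≤ φ y) : Tmax m α γ φ ≤ TmaxNonneg m α φ := by
  refine sSup_le_sSup ?_
  rintro τ ⟨T, hT, hτ, u, hu⟩
  exact ⟨T, hT, hτ, _, hu.isNonnegSolution hm hmN hγ hγN hα hα' hφX hφ0⟩

/-! ### Life span for large initial values -/

lemma ae_smul_of_ae {r : ℝ} (hr : r ≠ 0) {p : EuclideanSpace ℝ (Fin N) → Prop}
    (h : ∀ᵐ x, p x) : ∀ᵐ x, p (r • x) := by
  rw [← (measurableEmbedding_const_smul₀ hr).ae_map_iff (p := p),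
    Measure.map_addHaar_smul volume hr]
  exact Measure.ae_smul_measure h _

lemma le_rpow_of_mul_rpow_le_one {α β t l c : ℝ} (hα : 0 < α) (hκ : 0 < 1 / α - β) (ht : 0 < t)
    (hl : 0 < l) (hc : 0 < c) (h : α * t * (l * t ^ (-β) * c) ^ α ≤ 1) :
    t ≤ (l * (α ^ (1 / α) * c)) ^ (-(1 / α - β)⁻¹) := by
  set κ := 1 / α - β with hκdef
  have hX : t ^ κ * (l * (α ^ (1 / α) * c)) ≤ 1 := by
    by_contra! hX
    have h1 := Real.one_lt_rpow hX hα
    -- The hypothesis `h` is the `α`-th power of `t^κ l α^{1/α} c ≤ 1`.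
    have h2 : (t ^ κ * (l * (α ^ (1 / α) * c))) ^ α = α * t * (l * t ^ (-β) * c) ^ α := by
      have h3 : t ^ κ * (l * (α ^ (1 / α) * c))
          = (α ^ (1 / α) * t ^ (1 / α)) * (l * t ^ (-β) * c) := by
        rw [hκdef, sub_eq_add_neg, Real.rpow_add ht]
        ring
      rw [h3, Real.mul_rpow (by positivity) (by positivity), ← Real.mul_rpow hα.le ht.le,
        ← Real.rpow_mul (by positivity), one_div_mul_cancel hα.ne', Real.rpow_one]
    linarith
  have hpos : 0 < l * (α ^ (1 / α) * c) := by positivity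
  have h1 : t ^ κ ≤ (l * (α ^ (1 / α) * c))⁻¹ := by
    rw [inv_eq_one_div, le_div_iff₀ hpos]
    exact hX
  calc t = (t ^ κ) ^ κ⁻¹ := by rw [← Real.rpow_mul ht.le, mul_inv_cancel₀ hκ.ne', Real.rpow_one]
    _ ≤ ((l * (α ^ (1 / α) * c))⁻¹) ^ κ⁻¹ := by gcongr
    _ = _ := by rw [Real.inv_rpow hpos.le, Real.rpow_neg hpos.le]

lemma heatPos_eq_iSup_indicator (m : ℕ) (t : ℝ) {f : EuclideanSpace ℝ (Fin N) → ℝ≥0∞}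
    (hf : AEMeasurable f) (x : EuclideanSpace ℝ (Fin N)) :
    heatPos m t f x = ⨆ n : ℕ, heatPos m t ((Metric.closedBall 0 (n : ℝ)).indicator f) x := by
  unfold heatPos
  rw [← lintegral_iSup']
  · refine lintegral_congr fun y => ?_
    rw [← ENNReal.mul_iSup]
    congr 1
    refine le_antisymm ?_ (iSup_le fun n => indicator_le_self _ _ _)
    obtain ⟨n, hn⟩ := exists_nat_ge ‖y‖
    refine le_trans (le_of_eq ?_) (le_iSup _ n)
    rw [indicator_of_mem (by simpa using hn)]
  · exact fun n => (measurable_kernel_right m t x).ennreal_ofReal.aemeasurable.mul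
      (hf.indicator Metric.isClosed_closedBall.measurableSet).restrict
  · refine ae_of_all _ fun y i j hij => ?_
    dsimp only
    gcongr

/-- Monotone convergence over growing balls. The failure is stated almost everywhere because the
blow-up estimate holds only for almost every `x`, so a non-null set of good points is needed. -/
lemma exists_not_ae_heatPos_indicator_le {m : ℕ} {f : EuclideanSpace ℝ (Fin N) → ℝ≥0∞}
    (hf : AEMeasurable f) {c : ℝ≥0∞}
    (hc : c < essSup (heatPos m 1 f) (volume.restrict (sector N m))) :
    ∃ n : ℕ, ¬ ∀ᵐ x, x ∈ sector N m →
      heatPos m 1 ((Metric.closedBall 0 (n : ℝ)).indicator f) x ≤ c := by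
  by_contra! h
  refine hc.not_ge (essSup_le_of_ae_le c ((ae_restrict_iff' (measurableSet_sector m)).2 ?_))
  filter_upwards [ae_all_iff.2 h] with x hx hxS
  rw [heatPos_eq_iSup_indicator m 1 hf]
  exact iSup_le fun n => hx n hxS

/-- The threshold `t₀` depends on `c` and `ε` through the cut-off radius, but not on `l` or on the
solution, so that `l → ∞` is possible afterwards. -/
lemma exists_min_le_rpow {m : ℕ} (hm : 1 ≤ m) (hmN : m ≤ N) {α γ : ℝ} (hγ : 0 < γ) (hγN : γ < N)
    (hα : 0 < α) (hκ : 0 < 1 / α - (γ + m) / 2) {φ ω : EuclideanSpace ℝ (Fin N) → ℝ}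
    (hφ : AEStronglyMeasurable φ (volume.restrict (sector N m))) (hω : MemLp ω ∞)
    (hω_hom : HomogeneousZero ω) (hω0 : ∀ᵐ x, x ∈ sector N m → 0 ≤ ω x) {ε : ℝ} (hε : 0 < ε)
    (hφω : ∀ᵐ x, x ∈ sector N m → ‖x‖ ≤ ε → ω x * psi0 m γ x ≤ φ x) {c : ℝ} (hc : 0 < c)
    (hcS : ENNReal.ofReal c < heatSupNorm m γ ω) :
    ∃ t₀ : ℝ, 0 < t₀ ∧ ∀ l : ℝ, 0 < l → ∀ T : ℝ, 0 < T →
      ∀ u : ℝ → EuclideanSpace ℝ (Fin N) → ℝ≥0, IsNonnegSolution m α (fun x => l * φ x) T u →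
        min T t₀ ≤ (l * (α ^ (1 / α) * c)) ^ (-(1 / α - (γ + m) / 2)⁻¹) := by
  have hS := measurableSet_sector (N := N) m
  set f : EuclideanSpace ℝ (Fin N) → ℝ≥0∞ := fun y => ENNReal.ofReal (ω y * psi0 m γ y) with hf
  have hfm : AEMeasurable f :=
    (hω.1.aemeasurable.mul (measurable_psi0 m γ).aemeasurable).ennreal_ofReal
  rw [heatSupNorm_eq_essSup hm hmN hγ hγN hω hω0] at hcS
  obtain ⟨n, hn⟩ := exists_not_ae_heatPos_indicator_le hfm hcS
  have hn1 : (0 : ℝ) < n + 1 := by positivity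
  -- For `t ≤ t₀` the dilation by `√t` maps the ball of radius `n` into that of radius `ε`; `n + 1`
  -- avoids division by zero.
  refine ⟨(ε / (n + 1)) ^ 2, by positivity, fun l hl T hT u hu => ?_⟩
  have hae : ∀ᵐ t : ℝ, t ∈ Ioo 0 (min T ((ε / (n + 1)) ^ 2)) →
      t ≤ (l * (α ^ (1 / α) * c)) ^ (-(1 / α - (γ + m) / 2)⁻¹) := by
    filter_upwards [hu.mul_heatPos_rpow_le_one hα (hφ.const_mul l)] with t ht htI
    have ht0 := htI.1
    have hs := Real.sqrt_pos.2 ht0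
    have hsε : √t * n ≤ ε := by
      have h1 : √t ≤ ε / (n + 1) :=
        Real.sqrt_le_iff.2 ⟨by positivity, (htI.2.trans_le (min_le_right _ _)).le⟩
      rw [le_div_iff₀ hn1] at h1
      linarith
    have h1 := ae_smul_of_ae hs.ne' (ht ⟨ht0, htI.2.trans_le (min_le_left _ _)⟩)
    have hle : ∀ᵐ y, y ∈ sector N m → ENNReal.ofReal (l * t ^ (-((γ + m) / 2)))
        * (Metric.closedBall 0 (n : ℝ)).indicator f y ≤ ENNReal.ofReal (l * φ (√t • y)) := by
      filter_upwards [ae_smul_of_ae hs.ne' hφω, hω_hom _ hs] with y hy hyω hyS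
      by_cases hyn : y ∈ Metric.closedBall (0 : EuclideanSpace ℝ (Fin N)) (n : ℝ)
      · have h2 : ‖√t • y‖ ≤ ε := by
          rw [norm_smul, Real.norm_eq_abs, abs_of_pos hs]
          rw [mem_closedBall_zero_iff] at hyn
          exact (by gcongr : √t * ‖y‖ ≤ √t * n).trans hsε
        have h3 := hy ((smul_mem_sector hs).2 hyS) h2
        rw [hyω, psi0_smul γ hmN hs, sqrt_rpow_neg ht0, neg_div] at h3
        rw [indicator_of_mem hyn, hf, ← ENNReal.ofReal_mul (by positivity)]
        refine ENNReal.ofReal_le_ofReal ?_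
        calc l * t ^ (-((γ + m) / 2)) * (ω y * psi0 m γ y)
            = l * (ω y * (t ^ (-((γ + m) / 2)) * psi0 m γ y)) := by ring
          _ ≤ _ := by gcongr
      · rw [indicator_of_notMem hyn, mul_zero]
        exact zero_le
    -- A non-null set meets a set of full measure: `x` has cut-off heat value above `c`, and the
    -- blow-up estimate holds at `√t • x`.
    obtain ⟨x, hx, hx1⟩ := ((not_eventually.1 hn).and_eventually h1).exists
    rw [Classical.not_imp, not_le] at hx
    have h2 := hx1 ((smul_mem_sector hs).2 hx.1)
    have h3 := heatPos_smul m hs one_pos (fun y => ENNReal.ofReal (l * φ y)) x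
    rw [Real.sq_sqrt ht0.le, mul_one] at h3
    have h4 : ENNReal.ofReal (l * t ^ (-((γ + m) / 2)) * c)
        ≤ heatPos m t (fun y => ENNReal.ofReal (l * φ y)) (√t • x) := by
      rw [h3]
      refine le_trans ?_ (heatPos_mono_ae m 1 hle x)
      rw [heatPos_const_mul m 1 ENNReal.ofReal_ne_top, ENNReal.ofReal_mul (by positivity)]
      gcongr
      exact hx.2.le
    refine le_rpow_of_mul_rpow_le_one hα hκ ht0 hl hc (ENNReal.ofReal_le_one.1 ?_)
    rw [ENNReal.ofReal_mul (by positivity),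
      ← ENNReal.ofReal_rpow_of_nonneg (by positivity) hα.le]
    exact le_trans (by gcongr) h2
  -- If the bound failed, an interval of positive length would consist of exceptional times.
  by_contra! hlt
  set R := (l * (α ^ (1 / α) * c)) ^ (-(1 / α - (γ + m) / 2)⁻¹)
  have hR : 0 ≤ R := by positivity
  have hnull : volume (Ioo R (min T ((ε / (n + 1)) ^ 2))) = 0 := by
    refine measure_mono_null (fun t ht => ?_) hae
    exact fun h => ht.1.not_ge (h ⟨hR.trans_lt ht.1, ht.2⟩)
  rw [Real.volume_Ioo, ENNReal.ofReal_eq_zero] at hnull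
  linarith

lemma limsup_rpow_mul_le {a q σ : ℝ} (ha : 0 < a) (hσ : 0 < σ) {F : ℝ → ℝ≥0∞}
    (hF : ∀ c ∈ Ioo 0 σ, ∀ᶠ l : ℝ in atTop, F l ≤ ENNReal.ofReal ((l * (a * c)) ^ (-q))) :
    (∀ᶠ l : ℝ in atTop, F l < ∞) ∧
      limsup (fun l : ℝ => ENNReal.ofReal (l ^ q) * F l) atTop
        ≤ ENNReal.ofReal ((a * σ) ^ (-q)) := by
  refine ⟨(hF (σ / 2) ⟨by positivity, by linarith⟩).mono fun l hl =>
    hl.trans_lt ENNReal.ofReal_lt_top, ?_⟩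
  have hle : ∀ c ∈ Ioo 0 σ, limsup (fun l : ℝ => ENNReal.ofReal (l ^ q) * F l) atTop
      ≤ ENNReal.ofReal ((a * c) ^ (-q)) := fun c hc => by
    refine limsup_le_of_le (by isBoundedDefault) ?_
    filter_upwards [hF c hc, eventually_gt_atTop 0] with l hl hl0
    have hac : 0 < a * c := mul_pos ha hc.1
    calc ENNReal.ofReal (l ^ q) * F l
        ≤ ENNReal.ofReal (l ^ q) * ENNReal.ofReal ((l * (a * c)) ^ (-q)) := by gcongr
      _ = ENNReal.ofReal ((a * c) ^ (-q)) := by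
          rw [← ENNReal.ofReal_mul (by positivity), Real.mul_rpow hl0.le hac.le, ← mul_assoc,
            ← Real.rpow_add hl0, add_neg_cancel, Real.rpow_zero, one_mul]
  have hcont : Tendsto (fun c => ENNReal.ofReal ((a * c) ^ (-q))) (nhdsWithin σ (Iio σ))
      (nhds (ENNReal.ofReal ((a * σ) ^ (-q)))) := by
    refine (ENNReal.tendsto_ofReal ?_).mono_left nhdsWithin_le_nhds
    exact ((continuous_const.mul continuous_id).continuousAt).rpow_const
      (Or.inl (mul_pos ha hσ).ne')
  refine ge_of_tendsto hcont ?_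
  filter_upwards [Ioo_mem_nhdsLT hσ] with c hc using hle c hc

/-- For large `l` the bound drops below `t₀`, so the minimum in the hypothesis can only be `T`. -/
lemma eventually_TmaxNonneg_le {m : ℕ} {α a q t₀ : ℝ} (ha : 0 < a) (hq : 0 < q) (ht₀ : 0 < t₀)
    {φ : EuclideanSpace ℝ (Fin N) → ℝ}
    (h : ∀ l : ℝ, 0 < l → ∀ T : ℝ, 0 < T →
      ∀ u : ℝ → EuclideanSpace ℝ (Fin N) → ℝ≥0, IsNonnegSolution m α (fun x => l * φ x) T u →
        min T t₀ ≤ (l * a) ^ (-q)) :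
    ∀ᶠ l : ℝ in atTop, TmaxNonneg m α (fun x => l * φ x) ≤ ENNReal.ofReal ((l * a) ^ (-q)) := by
  have hlim : Tendsto (fun l : ℝ => (l * a) ^ (-q)) atTop (nhds 0) :=
    (tendsto_rpow_neg_atTop hq).comp (tendsto_id.atTop_mul_const ha)
  filter_upwards [hlim.eventually_lt_const ht₀, eventually_gt_atTop 0] with l hlt hl
  refine sSup_le ?_
  rintro τ ⟨T, hT, rfl, u, hu⟩
  refine ENNReal.ofReal_le_ofReal ?_
  rcases min_le_iff.1 (h l hl T hT u hu) with h1 | h1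
  · exact h1
  · exact absurd h1 hlt.not_ge

lemma MemX.const_mul {m : ℕ} {γ : ℝ} {φ : EuclideanSpace ℝ (Fin N) → ℝ} (h : MemX m γ φ) (l : ℝ) :
    MemX m γ fun x => l * φ x := by
  refine ⟨h.1.smul l, ?_⟩
  simpa only [mul_div_assoc] using h.2.const_mul l

lemma lifespanBound_eq {m : ℕ} {α γ σ : ℝ} (hα : 0 < α) (hσ : 0 < σ)
    {ω : EuclideanSpace ℝ (Fin N) → ℝ}
    (hω : heatSupNorm m γ ω = ENNReal.ofReal σ) :
    lifespanBound m α γ ω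
      = ENNReal.ofReal ((α ^ (1 / α) * σ) ^ (-(1 / α - (γ + m) / 2)⁻¹)) := by
  have hpos : 0 < α ^ (1 / α) * σ := by positivity
  rw [lifespanBound, hω, ← ENNReal.ofReal_mul (by positivity), ENNReal.ofReal_rpow_of_pos hpos,
    ← ENNReal.ofReal_inv_of_pos (by positivity), Real.rpow_neg hpos.le]

end SectorHeat

end

theorem theorem1p8 (N m : ℕ) (hm : 1 ≤ m) (hmN : m ≤ N) (α γ : ℝ)
    (hγ : 0 < γ) (hγN : γ < N) (hα : 0 < α) (hα' : α < 2 / (γ + m))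
    (φ ω : EuclideanSpace ℝ (Fin N) → ℝ)
    (hφ_loc : LocallyIntegrableOn φ {0}ᶜ)
    (hφ_anti : SectorHeat.AntiSymmetric m φ)
    (hφ_X : SectorHeat.MemX m γ φ)
    (hφ_nonneg : ∀ᵐ x, x ∈ SectorHeat.sector N m → 0 ≤ φ x)
    (hω_bdd : MemLp ω ∞)
    (hω_hom : SectorHeat.HomogeneousZero ω)
    (hω_anti : SectorHeat.AntiSymmetric m ω)
    (hω_nonneg : ∀ᵐ x, x ∈ SectorHeat.sector N m → 0 ≤ ω x)
    (hω_ne : ¬ (∀ᵐ x, ω x = 0))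
    (ε : ℝ) (hε : 0 < ε)
    (hφω : ∀ᵐ x, x ∈ SectorHeat.sector N m → ‖x‖ ≤ ε → ω x * SectorHeat.psi0 m γ x ≤ φ x) :
    (0 < SectorHeat.heatSupNorm m γ ω ∧ SectorHeat.heatSupNorm m γ ω < ∞) ∧
    ((∀ᶠ l : ℝ in atTop, SectorHeat.Tmax m α γ (fun x => l * φ x) < ∞) ∧
      limsup (fun l : ℝ => ENNReal.ofReal (l ^ (1 / α - (γ + m) / 2)⁻¹) *
          SectorHeat.Tmax m α γ (fun x => l * φ x)) atTop
        ≤ SectorHeat.lifespanBound m α γ ω) ∧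
    ((∀ᶠ l : ℝ in atTop, SectorHeat.TmaxNonneg m α (fun x => l * φ x) < ∞) ∧
      limsup (fun l : ℝ => ENNReal.ofReal (l ^ (1 / α - (γ + m) / 2)⁻¹) *
          SectorHeat.TmaxNonneg m α (fun x => l * φ x)) atTop
        ≤ SectorHeat.lifespanBound m α γ ω) := by
  have hκ : 0 < 1 / α - (γ + m) / 2 := by
    have hγm : 0 < γ + m := by positivity
    rw [lt_div_iff₀ hγm] at hα'
    rw [sub_pos, lt_div_iff₀ hα]
    linarith
  have hpos := SectorHeat.heatSupNorm_pos hm hmN hγ hγN hω_bdd hω_nonneg hω_anti hω_ne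
  have hlt := SectorHeat.heatSupNorm_lt_top hm hmN hγ hγN hω_bdd hω_nonneg
  have hσ := ENNReal.toReal_pos hpos.ne' hlt.ne
  have hσeq := (ENNReal.ofReal_toReal hlt.ne).symm
  have ha : 0 < α ^ (1 / α) := by positivity
  -- The bound is available only for `c` strictly below the norm, with a threshold for `l` depending
  -- on `c`; `limsup_rpow_mul_le` lets `c` increase after the limsup has been taken.
  have key : ∀ c ∈ Ioo 0 (SectorHeat.heatSupNorm m γ ω).toReal, ∀ᶠ l : ℝ in atTop,
      SectorHeat.TmaxNonneg m α (fun x => l * φ x)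
        ≤ ENNReal.ofReal ((l * (α ^ (1 / α) * c)) ^ (-(1 / α - (γ + m) / 2)⁻¹)) := by
    intro c hc
    obtain ⟨t₀, ht₀, h⟩ := SectorHeat.exists_min_le_rpow hm hmN hγ hγN hα hκ
      hφ_X.1.aestronglyMeasurable hω_bdd hω_hom hω_nonneg hε hφω hc.1
      ((ENNReal.ofReal_lt_iff_lt_toReal hc.1.le hlt.ne).2 hc.2)
    exact SectorHeat.eventually_TmaxNonneg_le (mul_pos ha hc.1) (inv_pos.2 hκ) ht₀ h
  rw [SectorHeat.lifespanBound_eq hα hσ hσeq]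
  refine ⟨⟨hpos, hlt⟩, SectorHeat.limsup_rpow_mul_le ha hσ fun c hc => ?_,
    SectorHeat.limsup_rpow_mul_le ha hσ key⟩
  filter_upwards [key c hc, eventually_gt_atTop 0] with l hl hl0
  refine (SectorHeat.Tmax_le_TmaxNonneg hm hmN hγ hγN hα hα' (hφ_X.const_mul l) ?_).trans hl
  exact hφ_nonneg.mono fun y hy hys => mul_nonneg hl0.le (hy hys)
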